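/- Let $k$ be a field. For an object $L$ of a category $\mathcal{C}$, a \emph{universal} (or \emph{extended}) \emph{endomorphism} of $L$ in $\mathcal{C}$ is an endomorphism (natural transformation to itself) of the forgetful functor $L\downarrow\mathcal{C}\to\mathcal{C}$, $(L\to M)\mapsto M$; that is, a choice of an endomorphism of $M$ in $\mathcal C$ for every morphism $L\to M$, compatible with all morphisms under $L$. (a) If $L$ is a Lie algebra over $k$ (of any characteristic), then the only universal endomorphisms of $L$ in the category $\mathrm{Lie}_k$ of Lie $k$-algebras are $0$ (the zero map of $M$ for every $L\to M$) and $\mathrm{id}$ (the identity of $M$ for every $L\to M$). (b) If $k$ has prime characteristic $p$ and $L$ is a restricted Lie algebra over $k$, then the only universal endomorphisms of $L$ in the category $\mathrm{Lie}_{k,p}$ of restricted Lie $k$-algebras (with Lie homomorphisms commuting with the $p$-maps) are $0$ and $\mathrm{id}$. -/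

import Mathlib

open CategoryTheory

universe u v

/-! ### Universal endomorphisms -/

/-- A universal (or extended) endomorphism of an object `L` of a category `C`: an endomorphism of
the forgetful functor `L ↓ C ⥤ C`, `(L ⟶ M) ↦ M`, i.e. a natural transformation from that functor
to itself. -/
abbrev UniversalEndomorphism {C : Type*} [Category C] (L : C) : Type _ :=
  Under.forget L ⟶ Under.forget L

/-! ### The category of Lie algebras over a field -/

/-- The objects of the category of Lie algebras over `k`. -/
structure LieAlgCat (k : Type u) [Field k] : Type (max u (v + 1)) where
  /-- The underlying type. -/
  carrier : Type v
  [lieRing : LieRing carrier]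
  [lieAlgebra : LieAlgebra k carrier]

namespace LieAlgCat

attribute [instance] lieRing lieAlgebra

variable {k : Type u} [Field k]

/-- Morphisms of Lie algebras. -/
@[ext]
structure Hom (L M : LieAlgCat.{u, v} k) : Type v where
  /-- The underlying Lie algebra homomorphism. -/
  hom : L.carrier →ₗ⁅k⁆ M.carrier

instance : Category (LieAlgCat.{u, v} k) where
  Hom L M := Hom L M
  id L := ⟨(LieHom.id : L.carrier →ₗ⁅k⁆ L.carrier)⟩
  comp f g := ⟨g.hom.comp f.hom⟩

instance : Limits.HasZeroMorphisms (LieAlgCat.{u, v} k) where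
  zero L M := ⟨(⟨0⟩ : Hom L M)⟩
  comp_zero _ _ := rfl
  zero_comp _ _ _ f := Hom.ext (LieHom.ext fun _ => f.hom.map_zero)

end LieAlgCat

/-! ### Restricted Lie algebras -/

/-- `jacobsonS k i m a b` is `i⁻¹` times the coefficient of `X ^ (i - 1)` in
`(ad (X a + b)) ^ m (a)`, for a central indeterminate `X`. Over a field of characteristic `p`, for
`m = p - 1` and `1 ≤ i ≤ p - 1`, this is the element `sᵢ(a, b)` of Jacobson's formula
`(a + b) ^ p = a ^ p + b ^ p + ∑ sᵢ(a, b)`. -/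
noncomputable def jacobsonS (k : Type*) {L : Type*} [Field k] [LieRing L] [LieAlgebra k L]
    (i m : ℕ) (a b : L) : L :=
  (i : k)⁻¹ • (((Polynomial.X * Polynomial.C (LieAlgebra.ad k L a) +
    Polynomial.C (LieAlgebra.ad k L b)) ^ m : Polynomial (Module.End k L)).coeff (i - 1)) a

/-- A restricted Lie algebra over a field `k` of characteristic `p`: a Lie algebra together with
a `p`-map `x ↦ x^[p]` satisfying Jacobson's axioms. (The class is used only when `p` is prime and
`k` has characteristic `p`.) -/
class RestrictedLieAlgebra (k : Type*) (p : ℕ) (L : Type*) [Field k] [LieRing L]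
    [LieAlgebra k L] where
  /-- The `p`-map `x ↦ x^[p]`. -/
  pMap : L → L
  pMap_smul : ∀ (c : k) (x : L), pMap (c • x) = c ^ p • pMap x
  pMap_add : ∀ x y : L,
    pMap (x + y) = pMap x + pMap y + ∑ i ∈ Finset.Ico 1 p, jacobsonS k i (p - 1) x y
  ad_pMap : ∀ x : L, LieAlgebra.ad k L (pMap x) = LieAlgebra.ad k L x ^ p

/-- The objects of the category of restricted Lie algebras over `k`, in characteristic `p`. -/
structure RestrictedLieAlgCat (k : Type u) (p : ℕ) [Field k] : Type (max u (v + 1)) where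
  /-- The underlying type. -/
  carrier : Type v
  [lieRing : LieRing carrier]
  [lieAlgebra : LieAlgebra k carrier]
  [restricted : RestrictedLieAlgebra k p carrier]

namespace RestrictedLieAlgCat

attribute [instance] lieRing lieAlgebra restricted

variable {k : Type u} {p : ℕ} [Field k]

/-- The `p`-map of a restricted Lie algebra. -/
def pMap (L : RestrictedLieAlgCat.{u, v} k p) (x : L.carrier) : L.carrier :=
  RestrictedLieAlgebra.pMap k p x

/-- Morphisms of restricted Lie algebras: the Lie algebra homomorphisms that commute with the
`p`-maps. -/
@[ext]
structure Hom (L M : RestrictedLieAlgCat.{u, v} k p) : Type v where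
  /-- The underlying Lie algebra homomorphism. -/
  hom : L.carrier →ₗ⁅k⁆ M.carrier
  map_pMap : ∀ x : L.carrier, hom (L.pMap x) = M.pMap (hom x)

instance : Category (RestrictedLieAlgCat.{u, v} k p) where
  Hom L M := Hom L M
  id L := ⟨(LieHom.id : L.carrier →ₗ⁅k⁆ L.carrier), fun _ => rfl⟩
  comp f g := ⟨g.hom.comp f.hom, fun x => by
    rw [LieHom.comp_apply, f.map_pMap, g.map_pMap, LieHom.comp_apply]⟩

theorem pMap_zero [hp : Fact p.Prime] (L : RestrictedLieAlgCat.{u, v} k p) : L.pMap 0 = 0 := by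
  have h := RestrictedLieAlgebra.pMap_smul (p := p) (0 : k) (0 : L.carrier)
  rwa [zero_smul, zero_pow hp.out.ne_zero, zero_smul] at h

instance [Fact p.Prime] : Limits.HasZeroMorphisms (RestrictedLieAlgCat.{u, v} k p) where
  zero L M := ⟨(⟨0, fun _ => M.pMap_zero.symm⟩ : Hom L M)⟩
  comp_zero _ _ := rfl
  zero_comp _ _ _ f := Hom.ext (LieHom.ext fun _ => f.hom.map_zero)

end RestrictedLieAlgCat

-- A natural endomorphism η is first tested on elements of a target M that commute with the image of
-- L. Naturality on M × L shows that η does not see a summand of L → M commuting with the part under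
-- study (`NatEndo.app_of_commute`). Hence η multiplies commuting elements y with y^[p] = 0 by one
-- scalar, and those with y^[p] = y by another. Brackets of 3×3 matrix units force the two scalars
-- to be equal and idempotent (`NatEndo.scalars_eq`), so both are 0 or both are 1.
--
-- An arbitrary x in M is reached through M[X] ⋊ kd, where d = X d/dX. Since d commutes with the
-- constants, η multiplies it by the scalar; moreover [d, Xx] = Xx, and X = 1 recovers x. If the
-- scalar is 0, then η = 0 (`NatEndo.app_eq_zero`). If it is 1, it suffices that η(x) - x is always
-- central (`NatEndo.app_eq_self`). By the adjoint representation, this follows once η is the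
-- identity on associative algebras.
--
-- For L → A placed at the entry (0,0) of 3×3 matrices, η sends E01(a) to E01(ua). The element u is
-- natural in A, so it comes from the (restricted) enveloping algebra. There it is group-like
-- (`NatEndo.envelopingComul_unit`), and the degree filtration leaves only u = 1
-- (`eq_one_of_envelopingComul_eq`); hence η is the identity on A (`NatEndo.endo_eq_self`).
--
-- In the restricted case M[X] and M[X] ⋊ kd need p-maps. Jacobson's correction sum is a symmetric
-- 2-cocycle, defining a vector space extension of N by its Frobenius twist. A p-map is a linear
-- section of it lying in `JacobsonExt.adSubmodule`, so it may be prescribed on monomials. The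
-- cocycle identities again come from the Euler derivation (`PolyLie.eq_zero_of_ad_eq_zero`). The
-- proposition `R` switches the p-maps on, so that one argument serves both cases.

universe w

attribute [local instance 100] LieRing.ofAssociativeRing

open scoped TensorProduct

/-! ### The coefficients of `(ad (X a + b)) ^ m` -/

section AdBinom

variable (k : Type*) [Field k] {N N' : Type*} [LieRing N] [LieAlgebra k N] [LieRing N']
  [LieAlgebra k N']

/-- The coefficient of `X ^ j` in `(ad (X a + b)) ^ m`. -/
noncomputable def adBinom (a b : N) (m j : ℕ) : Module.End k N :=
  ((Polynomial.X * Polynomial.C (LieAlgebra.ad k N a) +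
    Polynomial.C (LieAlgebra.ad k N b)) ^ m : Polynomial (Module.End k N)).coeff j

theorem jacobsonS_eq_adBinom (i m : ℕ) (a b : N) :
    jacobsonS k i m a b = (i : k)⁻¹ • adBinom k a b m (i - 1) a := rfl

theorem adBinom_zero_zero (a b : N) : adBinom k a b 0 0 = 1 := by
  simp [adBinom]

theorem adBinom_zero_succ (a b : N) (j : ℕ) : adBinom k a b 0 (j + 1) = 0 := by
  simp [adBinom, Polynomial.coeff_one]

theorem adBinom_succ_zero (a b x : N) (m : ℕ) :
    adBinom k a b (m + 1) 0 x = ⁅b, adBinom k a b m 0 x⁆ := by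
  simp [adBinom, pow_succ', add_mul, mul_assoc]

theorem adBinom_succ_succ (a b x : N) (m j : ℕ) :
    adBinom k a b (m + 1) (j + 1) x = ⁅a, adBinom k a b m j x⁆ + ⁅b, adBinom k a b m (j + 1) x⁆ := by
  simp [adBinom, pow_succ', add_mul, mul_assoc, Polynomial.coeff_X_mul]

/-- An induction principle for statements about the coefficients `adBinom k a b m j`. -/
theorem adBinom_induction {P : ℕ → ℕ → Prop} (h00 : P 0 0) (h0 : ∀ j, P 0 (j + 1))
    (h1 : ∀ m, P m 0 → P (m + 1) 0) (h2 : ∀ m j, P m j → P m (j + 1) → P (m + 1) (j + 1))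
    (m j : ℕ) : P m j := by
  induction m generalizing j with
  | zero => cases j with
    | zero => exact h00
    | succ j => exact h0 j
  | succ m ih => cases j with
    | zero => exact h1 m (ih 0)
    | succ j => exact h2 m j (ih j) (ih (j + 1))

theorem adBinom_of_lt (a b x : N) {m j : ℕ} (h : m < j) : adBinom k a b m j x = 0 := by
  revert h
  refine adBinom_induction (P := fun m j => m < j → adBinom k a b m j x = 0) ?_ ?_ ?_ ?_ m j
  · intro h; omega
  · intro j _; simp [adBinom_zero_succ]
  · intro m _ h; omega
  · intro m j h h' hlt
    rw [adBinom_succ_succ, h (by omega), h' (by omega)]; simp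

theorem map_adBinom (f : N →ₗ⁅k⁆ N') (a b x : N) (m j : ℕ) :
    f (adBinom k a b m j x) = adBinom k (f a) (f b) m j (f x) := by
  refine adBinom_induction
    (P := fun m j => f (adBinom k a b m j x) = adBinom k (f a) (f b) m j (f x)) ?_ ?_ ?_ ?_ m j
  · simp [adBinom_zero_zero]
  · simp [adBinom_zero_succ]
  · intro m h; rw [adBinom_succ_zero, adBinom_succ_zero, LieHom.map_lie, h]
  · intro m j h h'; rw [adBinom_succ_succ, adBinom_succ_succ, map_add, LieHom.map_lie,
      LieHom.map_lie, h, h']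

theorem adBinom_smul_smul (c : k) (a b x : N) (m j : ℕ) :
    adBinom k (c • a) (c • b) m j x = c ^ m • adBinom k a b m j x := by
  refine adBinom_induction
    (P := fun m j => adBinom k (c • a) (c • b) m j x = c ^ m • adBinom k a b m j x) ?_ ?_ ?_ ?_ m j
  · simp [adBinom_zero_zero]
  · simp [adBinom_zero_succ]
  · intro m h; simp only [adBinom_succ_zero, h, smul_lie, lie_smul, smul_smul, pow_succ]
  · intro m j h h'
    simp only [adBinom_succ_succ, h, h', smul_lie, lie_smul, smul_smul, pow_succ, smul_add]

theorem adBinom_eq_zero_of_lie_eq_zero {a b x : N} (ha : ⁅a, x⁆ = 0) (hb : ⁅b, x⁆ = 0) {m : ℕ}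
    (hm : m ≠ 0) (j : ℕ) : adBinom k a b m j x = 0 := by
  revert hm
  refine adBinom_induction (P := fun m j => m ≠ 0 → adBinom k a b m j x = 0) ?_ ?_ ?_ ?_ m j
  · simp
  · simp
  · intro m h _
    rw [adBinom_succ_zero]
    rcases eq_or_ne m 0 with rfl | hm
    · simp [adBinom_zero_zero, hb]
    · simp [h hm]
  · intro m j h h' _
    rw [adBinom_succ_succ]
    rcases eq_or_ne m 0 with rfl | hm
    · rcases j with _ | j <;> simp [ha, adBinom_zero_zero, adBinom_zero_succ]
    · simp [h hm, h' hm]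

/-- The sum of the correction terms in Jacobson's formula for `(a + b) ^ p`. -/
noncomputable def jacobsonSum (p : ℕ) (a b : N) : N :=
  ∑ i ∈ Finset.Ico 1 p, jacobsonS k i (p - 1) a b

theorem map_jacobsonSum (f : N →ₗ⁅k⁆ N') (p : ℕ) (a b : N) :
    f (jacobsonSum k p a b) = jacobsonSum k p (f a) (f b) := by
  simp [jacobsonSum, jacobsonS_eq_adBinom, map_adBinom]

/-- Each term is a bracket of p letters: p - 1 operators and the element they act on. -/
theorem jacobsonSum_smul_smul {p : ℕ} (hp : p.Prime) (c : k) (a b : N) :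
    jacobsonSum k p (c • a) (c • b) = c ^ p • jacobsonSum k p a b := by
  simp only [jacobsonSum, jacobsonS_eq_adBinom, adBinom_smul_smul, Finset.smul_sum, map_smul]
  refine Finset.sum_congr rfl fun i _ => ?_
  rw [smul_smul, smul_smul, smul_smul, mul_assoc, ← pow_succ', Nat.sub_add_cancel hp.one_le,
    mul_comm]

/-- Each term applies words of p - 1 ≥ 1 operators `ad a`, `ad b` to `a`, and the innermost operator
already kills `a`. -/
theorem jacobsonSum_eq_zero_of_lie_eq_zero {p : ℕ} (hp : p.Prime) {a b : N} (h : ⁅a, b⁆ = 0) :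
    jacobsonSum k p a b = 0 := by
  have hb : ⁅b, a⁆ = 0 := by rw [← lie_skew, h, neg_zero]
  have := hp.two_le
  exact Finset.sum_eq_zero fun i _ => by
    rw [jacobsonS_eq_adBinom, adBinom_eq_zero_of_lie_eq_zero k (lie_self a) hb (by omega),
      smul_zero]

theorem jacobsonSum_zero_left {p : ℕ} (hp : p.Prime) (b : N) : jacobsonSum k p 0 b = 0 :=
  jacobsonSum_eq_zero_of_lie_eq_zero k hp (zero_lie b)

theorem jacobsonSum_zero_right {p : ℕ} (hp : p.Prime) (a : N) : jacobsonSum k p a 0 = 0 :=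
  jacobsonSum_eq_zero_of_lie_eq_zero k hp (lie_zero a)

end AdBinom

/-! ### Jacobson's formula in associative algebras -/

section Associative

theorem choose_pred_prime_cast {R : Type*} [Ring R] {p : ℕ} (hp : p.Prime) [CharP R p] {i : ℕ}
    (hi : i < p) : ((p - 1).choose i : R) = (-1) ^ i := by
  induction i with
  | zero => simp
  | succ i ih =>
    have h : ((p - 1).choose i : R) + ((p - 1).choose (i + 1) : R) = 0 := by
      rw [← Nat.cast_add, ← Nat.choose_succ_succ, Nat.succ_eq_add_one, Nat.succ_eq_add_one,
        Nat.sub_add_cancel hp.one_le]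
      exact (CharP.cast_eq_zero_iff R p _).2 (hp.dvd_choose_self (by omega) hi)
    rw [ih (by omega)] at h
    rw [pow_succ, eq_neg_of_add_eq_zero_right h]; simp

/-- In characteristic p the binomial coefficient of p - 1 over i is (-1)^i, which cancels the signs
of the expansion. With right and left multiplication by w for x and y, it turns (ad w)^(p-1) into
the sum that arises from differentiating w^p. -/
theorem Commute.sub_pow_pred_prime {R : Type*} [Ring R] {p : ℕ} (hp : p.Prime) [CharP R p]
    {x y : R} (h : Commute x y) :
    (y - x) ^ (p - 1) = ∑ i ∈ Finset.range p, x ^ i * y ^ (p - 1 - i) := by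
  have h' : Commute (-x) y := h.neg_left
  rw [sub_eq_neg_add, h'.add_pow, Nat.sub_add_cancel hp.one_le]
  refine Finset.sum_congr rfl fun i hi => ?_
  have hi := Finset.mem_range.1 hi
  rw [choose_pred_prime_cast hp hi, neg_pow x]
  rw [((Commute.neg_one_left x).pow_pow i i).eq]
  rw [mul_assoc, mul_assoc, ((Commute.neg_one_right (y ^ (p - 1 - i))).pow_right i).eq,
    ← mul_assoc ((-1) ^ i), ← mul_pow]
  · simp
  · rfl

variable (k : Type*) [Field k] {A : Type*} [Ring A] [Algebra k A]

open Polynomial in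
theorem derivative_pow_eq_sum (w : A[X]) (n : ℕ) :
    derivative (w ^ n) = ∑ i ∈ Finset.range n, w ^ i * derivative w * w ^ (n - 1 - i) := by
  induction n with
  | zero => simp
  | succ n ih =>
    rw [pow_succ, derivative_mul, ih, Finset.sum_range_succ, Finset.sum_mul]
    congr 1
    · refine Finset.sum_congr rfl fun i hi => ?_
      have hi := Finset.mem_range.1 hi
      rw [mul_assoc, ← pow_succ]
      congr 2; omega
    · simp

-- Jacobson's argument takes place in A[X], whereas `jacobsonS` uses polynomials over End A; this
-- identifies the two.
open Polynomial in
theorem coeff_ad_pow (a b x : A) (m j : ℕ) :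
    (((LieAlgebra.ad k A[X] (X * C a + C b)) ^ m) (C x)).coeff j = adBinom k a b m j x := by
  induction m generalizing j with
  | zero => cases j with
    | zero => simp [adBinom_zero_zero]
    | succ j => simp [adBinom_zero_succ]
  | succ m ih =>
    rw [pow_succ', Module.End.mul_apply, LieAlgebra.ad_apply, LieRing.of_associative_ring_bracket]
    generalize ((LieAlgebra.ad k A[X] (X * C a + C b)) ^ m) (C x) = q at ih
    have hq : q * (X * C a + C b) = X * (q * C a) + q * C b := by
      rw [mul_add, ← mul_assoc, ← mul_assoc, X_mul]
    rw [hq]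
    cases j with
    | zero =>
      rw [adBinom_succ_zero, ← ih, LieRing.of_associative_ring_bracket]
      simp [add_mul, mul_assoc]
    | succ j =>
      rw [adBinom_succ_succ, ← ih, ← ih, LieRing.of_associative_ring_bracket,
        LieRing.of_associative_ring_bracket]
      simp only [add_mul, mul_assoc, coeff_sub, coeff_add, coeff_X_mul, coeff_C_mul, coeff_mul_C]
      abel

/-- `ad x` is the difference of two commuting operators, left and right multiplication, and the p-th
power is additive on commuting elements. -/
theorem ad_pow_char {p : ℕ} (hp : p.Prime) [CharP k p] (x : A) :
    LieAlgebra.ad k A (x ^ p) = LieAlgebra.ad k A x ^ p := by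
  have := Fact.mk hp
  rcases subsingleton_or_nontrivial A with hA | hA
  · ext; exact Subsingleton.elim _ _
  have : CharP (Module.End k A) p :=
    charP_of_injective_algebraMap (FaithfulSMul.algebraMap_injective k (Module.End k A)) p
  have : ExpChar (Module.End k A) p := ExpChar.prime hp
  rw [LieAlgebra.ad_eq_lmul_left_sub_lmul_right]
  simp only [Pi.sub_apply]
  rw [sub_pow_expChar_of_commute _ (LinearMap.commute_mulLeft_right x x)]
  simp [LinearMap.pow_mulLeft, LinearMap.pow_mulRight]

open Polynomial in
/-- Jacobson's formula. -/
theorem add_pow_char_eq_jacobsonSum {p : ℕ} (hp : p.Prime) [CharP k p] (a b : A) :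
    (a + b) ^ p = a ^ p + b ^ p + jacobsonSum k p a b := by
  have := Fact.mk hp
  rcases subsingleton_or_nontrivial A with hA | hA
  · exact Subsingleton.elim _ _
  have : CharP A p := charP_of_injective_algebraMap (FaithfulSMul.algebraMap_injective k A) p
  have : CharP (Module.End k A[X]) p :=
    charP_of_injective_algebraMap (FaithfulSMul.algebraMap_injective k _) p
  -- The derivative of w^p is (ad w)^(p-1)(a), so each coefficient of w^p strictly between degrees 0
  -- and p is some sᵢ(a, b), after division by i. The value at X = 1 is then the formula.
  set w : A[X] := X * C a + C b with hw
  have hdw : derivative w = C a := by simp [hw]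
  have hd : derivative (w ^ p) = (LieAlgebra.ad k A[X] w ^ (p - 1)) (C a) := by
    rw [derivative_pow_eq_sum, hdw, LieAlgebra.ad_eq_lmul_left_sub_lmul_right, Pi.sub_apply,
      (LinearMap.commute_mulLeft_right w w).symm.sub_pow_pred_prime hp, LinearMap.sum_apply,
      ← Finset.sum_range_reflect]
    refine Finset.sum_congr rfl fun i hi => ?_
    have hi := Finset.mem_range.1 hi
    rw [Module.End.mul_apply, LinearMap.pow_mulLeft, LinearMap.pow_mulRight,
      LinearMap.mulLeft_apply, LinearMap.mulRight_apply]
    congr 2; omega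
  have hdeg : w.natDegree ≤ 1 := by
    rw [hw, X_mul_C]; compute_degree
  have hcoeff : ∀ i ∈ Finset.Ico 1 p, (w ^ p).coeff i = jacobsonS k i (p - 1) a b := by
    intro i hi
    obtain ⟨h1, h2⟩ := Finset.mem_Ico.1 hi
    have hi0 : (i : k) ≠ 0 := fun h =>
      absurd (Nat.le_of_dvd h1 ((CharP.cast_eq_zero_iff k p i).1 h)) (by omega)
    have h := congrArg (fun q => coeff q (i - 1)) hd
    simp only [coeff_derivative, hw, coeff_ad_pow] at h
    rw [Nat.sub_add_cancel h1] at h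
    have hi1 : ((i - 1 : ℕ) : A) + 1 = algebraMap k A i := by
      rw [map_natCast, ← Nat.cast_succ, Nat.succ_eq_add_one, Nat.sub_add_cancel h1]
    rw [jacobsonS_eq_adBinom, ← h, eq_inv_smul_iff₀ hi0, hi1, Algebra.smul_def,
      Algebra.commutes]
  have h0 : (w ^ p).coeff 0 = b ^ p := by
    rw [← constantCoeff_apply, map_pow]; simp [hw]
  have hp' : (w ^ p).coeff p = a ^ p := by
    have := coeff_pow_of_natDegree_le (m := p) hdeg
    rw [mul_one] at this
    rw [this]; simp [hw, coeff_C]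
  -- Evaluation at 1 is multiplicative even for noncommutative A, since 1 is central.
  let φ : A[X] →+* A := eval₂RingHom' (RingHom.id A) 1 fun x => Commute.one_right x
  have hφ : φ (w ^ p) = (a + b) ^ p := by
    rw [map_pow]; simp [φ, hw]
  have hdeg' : (w ^ p).natDegree < p + 1 := by
    have := natDegree_pow_le (p := w) (n := p)
    nlinarith
  have hsum : φ (w ^ p) = ∑ i ∈ Finset.range (p + 1), (w ^ p).coeff i := by
    change eval₂ _ _ _ = _
    rw [eval₂_eq_sum_range' _ hdeg']; simp
  rw [← hφ, hsum, Finset.sum_range_succ, hp', Finset.range_eq_Ico,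
    Finset.sum_eq_sum_Ico_succ_bot hp.pos, h0, jacobsonSum, Finset.sum_congr rfl hcoeff]
  abel

/-- Jacobson's formula under `ad`, in an arbitrary Lie algebra. -/
theorem ad_jacobsonSum {N : Type*} [LieRing N] [LieAlgebra k N] {p : ℕ} (hp : p.Prime) [CharP k p]
    (a b : N) : LieAlgebra.ad k N (jacobsonSum k p a b) =
      (LieAlgebra.ad k N (a + b)) ^ p - LieAlgebra.ad k N a ^ p - LieAlgebra.ad k N b ^ p := by
  -- `ad` is a Lie homomorphism into an associative algebra, where Jacobson's formula is available.
  rw [map_jacobsonSum, map_add, add_pow_char_eq_jacobsonSum k hp]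
  abel

end Associative

/-! ### Polynomials with coefficients in a Lie algebra -/

/-- The Lie algebra `k[X] ⊗ N` of polynomials with coefficients in `N`. -/
def PolyLie (k : Type*) [Field k] (N : Type*) [LieRing N] [LieAlgebra k N] : Type _ :=
  Polynomial k ⊗[k] N

namespace PolyLie

variable (k : Type*) [Field k] {N N' Q : Type*} [LieRing N] [LieAlgebra k N] [LieRing N']
  [LieAlgebra k N'] [AddCommGroup Q] [Module k Q]

noncomputable instance : LieRing (PolyLie k N) :=
  inferInstanceAs (LieRing (Polynomial k ⊗[k] N))

noncomputable instance : LieAlgebra k (PolyLie k N) :=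
  inferInstanceAs (LieAlgebra k (Polynomial k ⊗[k] N))

/-- The identification of `PolyLie k N` with a tensor product of vector spaces. -/
noncomputable def toTensor (N : Type*) [LieRing N] [LieAlgebra k N] :
    PolyLie k N ≃ₗ[k] Polynomial k ⊗[k] N :=
  LinearEquiv.refl k (Polynomial k ⊗[k] N)

/-- The monomial `X ^ i ⊗ x`. -/
noncomputable def mon (i : ℕ) : N →ₗ[k] PolyLie k N :=
  (toTensor k N).symm ∘ₗ TensorProduct.mk k (Polynomial k) N (Polynomial.monomial i 1)

theorem toTensor_mon (i : ℕ) (x : N) :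
    toTensor k N (mon k i x) = Polynomial.monomial i (1 : k) ⊗ₜ[k] x := rfl

theorem lie_mon_mon (i j : ℕ) (x y : N) : ⁅mon k i x, mon k j y⁆ = mon k (i + j) ⁅x, y⁆ := by
  change (Polynomial.monomial i (1 : k) * Polynomial.monomial j (1 : k)) ⊗ₜ[k] ⁅x, y⁆ =
    Polynomial.monomial (i + j) (1 : k) ⊗ₜ[k] ⁅x, y⁆
  rw [Polynomial.monomial_mul_monomial, one_mul]

theorem toTensor_symm_tmul (i : ℕ) (c : k) (x : N) :
    (toTensor k N).symm (Polynomial.monomial i c ⊗ₜ[k] x) = mon k i (c • x) := by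
  apply (toTensor k N).injective
  rw [LinearEquiv.apply_symm_apply, toTensor_mon, TensorProduct.tmul_smul,
    TensorProduct.smul_tmul', Polynomial.smul_monomial, smul_eq_mul, mul_one]

theorem induction {P : PolyLie k N → Prop} (hadd : ∀ x y, P x → P y → P (x + y))
    (hmon : ∀ i x, P (mon k i x)) (x : PolyLie k N) : P x := by
  have h0 : P 0 := by simpa using hmon 0 0
  suffices h : ∀ y, P ((toTensor k N).symm y) by simpa using h (toTensor k N x)
  intro y
  refine TensorProduct.induction_on y (by simpa) ?_ ?_
  · intro q y
    induction q using Polynomial.induction_on' with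
    | add a b ha hb => rw [TensorProduct.add_tmul, map_add]; exact hadd _ _ ha hb
    | monomial n a => rw [toTensor_symm_tmul]; exact hmon _ _
  · intro a b ha hb
    rw [map_add]; exact hadd _ _ ha hb

theorem linearMap_ext {f g : PolyLie k N →ₗ[k] Q} (h : ∀ i x, f (mon k i x) = g (mon k i x)) :
    f = g :=
  LinearMap.ext fun x => induction k (P := fun x => f x = g x)
    (fun x y hx hy => by rw [map_add, map_add, hx, hy]) h x

/-- The linear map on `k[X] ⊗ N` with given restrictions to the spaces of monomials. -/
noncomputable def lift (σ : ℕ → N →ₗ[k] Q) : PolyLie k N →ₗ[k] Q :=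
  TensorProduct.lift ((Polynomial.basisMonomials k).constr k σ) ∘ₗ (toTensor k N).toLinearMap

@[simp]
theorem lift_mon (σ : ℕ → N →ₗ[k] Q) (i : ℕ) (x : N) : lift k σ (mon k i x) = σ i x := by
  have := (Polynomial.basisMonomials k).constr_basis k σ i
  rw [Polynomial.coe_basisMonomials] at this
  rw [lift, LinearMap.comp_apply, LinearEquiv.coe_coe, toTensor_mon, TensorProduct.lift.tmul, this]

/-- The `n`-th coefficient. -/
noncomputable def coeff (n : ℕ) : PolyLie k N →ₗ[k] N :=
  lift k fun i => if i = n then LinearMap.id else 0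

theorem coeff_mon (n i : ℕ) (x : N) : coeff k n (mon k i x) = if i = n then x else 0 := by
  rw [coeff, lift_mon]; split_ifs <;> rfl

theorem ext_coeff {x : PolyLie k N} (h : ∀ n, coeff k n x = 0) : x = 0 := by
  let e := toTensor k N ≪≫ₗ TensorProduct.equivFinsuppOfBasisLeft (N := N) (Polynomial.basisMonomials k)
  have he : ∀ n y, e y n = coeff k n y := by
    intro n y
    refine induction k (P := fun y => e y n = coeff k n y) ?_ ?_ y
    · intro x y hx hy; rw [map_add, map_add, Finsupp.add_apply, hx, hy]
    · intro i x
      rw [LinearEquiv.trans_apply, toTensor_mon,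
        TensorProduct.equivFinsuppOfBasisLeft_apply_tmul_apply, coeff_mon]
      simp [Polynomial.basisMonomials, Finsupp.single_apply]
  apply e.injective
  ext n
  rw [he, h, map_zero]; rfl

/-- Evaluation of a polynomial with coefficients in a Lie algebra at a scalar. -/
noncomputable def eval (c : k) : PolyLie k N →ₗ⁅k⁆ N where
  __ := lift k fun i => c ^ i • LinearMap.id
  map_lie' {x y} := by
    change lift k _ _ = ⁅lift k _ _, lift k _ _⁆
    refine induction k (P := fun x => ∀ y, lift k (fun i => c ^ i • LinearMap.id) ⁅x, y⁆ =
      ⁅lift k (fun i => c ^ i • LinearMap.id) x, lift k (fun i => c ^ i • LinearMap.id) y⁆)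
      ?_ ?_ x y
    · intro x x' hx hx' y
      rw [add_lie, map_add, map_add, add_lie, hx, hx']
    · intro i x y
      refine induction k (P := fun y => lift k (fun i => c ^ i • LinearMap.id) ⁅mon k i x, y⁆ =
        ⁅lift k (fun i => c ^ i • LinearMap.id) (mon k i x),
          lift k (fun i => c ^ i • LinearMap.id) y⁆) ?_ ?_ y
      · intro x x' hx hx'
        rw [lie_add, map_add, map_add, lie_add, hx, hx']
      · intro j y
        simp [lie_mon_mon, smul_smul, pow_add, mul_comm]

@[simp]
theorem eval_mon (c : k) (i : ℕ) (x : N) : eval k c (mon k i x) = c ^ i • x :=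
  lift_mon k _ i x

/-- The inclusion of the constant polynomials. -/
noncomputable def const : N →ₗ⁅k⁆ PolyLie k N where
  __ := mon k 0
  map_lie' {x y} := (lie_mon_mon k 0 0 x y).symm

/-- The Euler derivation `X d/dX`. -/
noncomputable def euler : LieDerivation k (PolyLie k N) (PolyLie k N) where
  __ := lift k fun i => (i : k) • mon k i
  leibniz' x y := by
    set d : PolyLie k N →ₗ[k] PolyLie k N := lift k fun i => (i : k) • mon k i with hd
    change d ⁅x, y⁆ = ⁅x, d y⁆ - ⁅y, d x⁆
    refine induction k (P := fun x => ∀ y, d ⁅x, y⁆ = ⁅x, d y⁆ - ⁅y, d x⁆) ?_ ?_ x y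
    · intro x x' hx hx' y
      rw [add_lie, map_add, map_add, add_lie, lie_add, hx, hx']; abel
    · intro i x y
      refine induction k (P := fun y => d ⁅mon k i x, y⁆ =
        ⁅mon k i x, d y⁆ - ⁅y, d (mon k i x)⁆) ?_ ?_ y
      · intro x x' hx hx'
        rw [lie_add, map_add, map_add, add_lie, lie_add, hx, hx']; abel
      · intro j y
        simp only [hd, lie_mon_mon, lift_mon, LinearMap.smul_apply, lie_smul]
        rw [← lie_skew y x, map_neg, add_comm j i, smul_neg, sub_neg_eq_add, ← add_smul,
          Nat.cast_add, add_comm (i : k)]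

@[simp]
theorem euler_mon (i : ℕ) (x : N) : euler k (mon k i x) = (i : k) • mon k i x :=
  lift_mon k _ i x

theorem coeff_euler (n : ℕ) (x : PolyLie k N) :
    coeff k n (euler k x) = (n : k) • coeff k n x := by
  refine induction k (P := fun x => coeff k n (euler k x) = (n : k) • coeff k n x) ?_ ?_ x
  · intro x y hx hy; simp only [map_add, hx, hy, smul_add]
  · intro i x
    rw [euler_mon, map_smul, coeff_mon]
    split_ifs with h
    · rw [h]
    · simp

/-- The action of the one-dimensional Lie algebra `k` on `k[X] ⊗ N` by multiples of the Euler
derivation. -/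
noncomputable def eulerAction (N : Type*) [LieRing N] [LieAlgebra k N] :
    k →ₗ⁅k⁆ LieDerivation k (PolyLie k N) (PolyLie k N) where
  __ := LinearMap.toSpanSingleton k _ (euler k)
  map_lie' {a b} := by
    change ⁅a, b⁆ • euler k = ⁅a • euler k, b • euler k⁆
    rw [LieRing.of_associative_ring_bracket, mul_comm, sub_self, zero_smul]
    ext x
    simp

theorem eulerAction_apply (c : k) (x : PolyLie k N) : eulerAction k N c x = c • euler k x := rfl

end PolyLie

/-- The semidirect sum of `k[X] ⊗ N` and the span of the Euler derivation. -/
abbrev EulerLie (k : Type*) [Field k] (N : Type*) [LieRing N] [LieAlgebra k N] : Type _ :=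
  LieAlgebra.SemiDirectSum (PolyLie k N) k (PolyLie.eulerAction k N)

namespace EulerLie

variable (k : Type*) [Field k] {N : Type*} [LieRing N] [LieAlgebra k N]

/-- The inclusion of `k[X] ⊗ N`. -/
noncomputable def inl : PolyLie k N →ₗ⁅k⁆ EulerLie k N :=
  LieAlgebra.SemiDirectSum.inl _

/-- The inclusion of the span of the Euler derivation. -/
noncomputable def inr : k →ₗ⁅k⁆ EulerLie k N :=
  LieAlgebra.SemiDirectSum.inr _

theorem inl_injective : Function.Injective (inl k : PolyLie k N → EulerLie k N) :=
  fun _ _ h => congrArg LieAlgebra.SemiDirectSum.left h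

theorem lie_inr_inl (c : k) (x : PolyLie k N) :
    ⁅(inr k c : EulerLie k N), inl k x⁆ = inl k (c • PolyLie.euler k x) := by
  apply LieAlgebra.SemiDirectSum.ext
  · change ⁅(0 : PolyLie k N), x⁆ + PolyLie.eulerAction k N c x - PolyLie.eulerAction k N 0 0 =
      c • PolyLie.euler k x
    rw [zero_lie, zero_add, map_zero, sub_zero, PolyLie.eulerAction_apply]
  · change ⁅c, (0 : k)⁆ = 0
    rw [lie_zero]

theorem inl_add_inr (x : EulerLie k N) : x = inl k x.left + inr k x.right := by
  simp [inl, inr]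

end EulerLie

/-! ### Symmetry and cocycle identities -/

namespace PolyLie

variable (k : Type*) [Field k] {N : Type*} [LieRing N] [LieAlgebra k N]

/-- The polynomials of degree at most `d`. -/
noncomputable def degreeLE (N : Type*) [LieRing N] [LieAlgebra k N] (d : ℕ) :
    Submodule k (PolyLie k N) :=
  Submodule.span k {x | ∃ i ≤ d, ∃ y, x = mon k i y}

theorem mon_mem_degreeLE {i d : ℕ} (h : i ≤ d) (x : N) : mon k i x ∈ degreeLE k N d :=
  Submodule.subset_span ⟨i, h, x, rfl⟩

theorem degreeLE_mono {d e : ℕ} (h : d ≤ e) : degreeLE k N d ≤ degreeLE k N e :=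
  Submodule.span_mono fun _ ⟨i, hi, y, hy⟩ => ⟨i, hi.trans h, y, hy⟩

theorem lie_mem_degreeLE {d e : ℕ} {x y : PolyLie k N} (hx : x ∈ degreeLE k N d)
    (hy : y ∈ degreeLE k N e) : ⁅x, y⁆ ∈ degreeLE k N (d + e) := by
  induction hx using Submodule.span_induction with
  | zero => rw [zero_lie]; exact zero_mem _
  | add a b _ _ ha hb => rw [add_lie]; exact add_mem ha hb
  | smul c a _ ha => rw [smul_lie]; exact Submodule.smul_mem _ c ha
  | mem a ha =>
    obtain ⟨i, hi, a, rfl⟩ := ha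
    induction hy using Submodule.span_induction with
    | zero => rw [lie_zero]; exact zero_mem _
    | add a b _ _ ha hb => rw [lie_add]; exact add_mem ha hb
    | smul c a _ ha => rw [lie_smul]; exact Submodule.smul_mem _ c ha
    | mem b hb =>
      obtain ⟨j, hj, b, rfl⟩ := hb
      rw [lie_mon_mon]
      exact mon_mem_degreeLE k (by omega) _

theorem coeff_eq_zero_of_mem_degreeLE {d n : ℕ} (h : d < n) {x : PolyLie k N}
    (hx : x ∈ degreeLE k N d) : coeff k n x = 0 := by
  induction hx using Submodule.span_induction with
  | zero => exact map_zero _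
  | add a b _ _ ha hb => rw [map_add, ha, hb, add_zero]
  | smul c a _ ha => rw [map_smul, ha, smul_zero]
  | mem a ha =>
    obtain ⟨i, hi, a, rfl⟩ := ha
    rw [coeff_mon, if_neg (by omega)]

theorem adBinom_mem_degreeLE {a b x : PolyLie k N} {d e f : ℕ} (ha : a ∈ degreeLE k N d)
    (hb : b ∈ degreeLE k N e) (hx : x ∈ degreeLE k N f) (m j : ℕ) :
    adBinom k a b m j x ∈ degreeLE k N (j * d + (m - j) * e + f) := by
  refine adBinom_induction
    (P := fun m j => adBinom k a b m j x ∈ degreeLE k N (j * d + (m - j) * e + f)) ?_ ?_ ?_ ?_ m j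
  · simpa [adBinom_zero_zero]
  · intro j; simp [adBinom_zero_succ]
  · intro m h
    rw [adBinom_succ_zero]
    refine degreeLE_mono k (le_of_eq ?_) (lie_mem_degreeLE k hb h)
    simp; ring
  · intro m j h h'
    rw [adBinom_succ_succ]
    refine add_mem ?_ ?_
    · refine degreeLE_mono k (le_of_eq ?_) (lie_mem_degreeLE k ha h)
      rw [Nat.add_sub_add_right]; ring
    · rcases lt_or_ge m (j + 1) with hlt | hge
      · rw [adBinom_of_lt k _ _ _ hlt, lie_zero]; exact zero_mem _
      · refine degreeLE_mono k (le_of_eq ?_) (lie_mem_degreeLE k hb h')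
        obtain ⟨r, rfl⟩ := Nat.exists_eq_add_of_le hge
        have h1 : j + 1 + r - (j + 1) = r := by omega
        have h2 : j + 1 + r + 1 - (j + 1) = r + 1 := by omega
        rw [h1, h2]; ring

/-- The i-th term contains `a` exactly i times, counting the element acted on, and i < p. -/
theorem jacobsonSum_mem_degreeLE_left {p : ℕ} {a b : PolyLie k N}
    (ha : a ∈ degreeLE k N 1) (hb : b ∈ degreeLE k N 0) :
    jacobsonSum k p a b ∈ degreeLE k N (p - 1) := by
  refine sum_mem fun i hi => ?_
  have hi := Finset.mem_Ico.1 hi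
  rw [jacobsonS_eq_adBinom]
  refine Submodule.smul_mem _ _ (degreeLE_mono k ?_ (adBinom_mem_degreeLE k ha hb ha _ _))
  simp only [mul_one, mul_zero]; omega

/-- The i-th term contains `b` exactly p - i times, and i ≥ 1. -/
theorem jacobsonSum_mem_degreeLE_right {p : ℕ} {a b : PolyLie k N}
    (ha : a ∈ degreeLE k N 0) (hb : b ∈ degreeLE k N 1) :
    jacobsonSum k p a b ∈ degreeLE k N (p - 1) := by
  refine sum_mem fun i hi => ?_
  have hi := Finset.mem_Ico.1 hi
  rw [jacobsonS_eq_adBinom]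
  refine Submodule.smul_mem _ _ (degreeLE_mono k ?_ (adBinom_mem_degreeLE k ha hb ha _ _))
  simp only [mul_one, mul_zero]; omega

theorem coeff_zero_eq_eval (x : PolyLie k N) : coeff k 0 x = eval k 0 x := by
  refine induction k (P := fun x => coeff k 0 x = eval k 0 x) ?_ ?_ x
  · intro x y hx hy; rw [map_add, map_add, hx, hy]
  · intro i x
    rw [coeff_mon, eval_mon]
    rcases i with _ | i <;> simp

/-- A polynomial of degree less than `p` without constant term that commutes with the Euler
derivation vanishes. -/
theorem eq_zero_of_ad_eq_zero {p : ℕ} (hp : p.Prime) [CharP k p] {x : PolyLie k N}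
    (hx : x ∈ degreeLE k N (p - 1)) (h0 : eval k 0 x = 0)
    (had : LieAlgebra.ad k (EulerLie k N) (EulerLie.inl k x) = 0) : x = 0 := by
  -- Bracketing with the Euler derivation gives n xₙ = 0 for every coefficient, and n is invertible
  -- for 0 < n < p.
  have he : euler k x = 0 := by
    apply EulerLie.inl_injective k
    have := EulerLie.lie_inr_inl k 1 x
    rw [one_smul] at this
    rw [← this, ← lie_skew, ← LieAlgebra.ad_apply (R := k), had]; simp
  refine ext_coeff k fun n => ?_
  rcases Nat.eq_zero_or_pos n with rfl | hn
  · rw [coeff_zero_eq_eval, h0]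
  rcases lt_or_ge n p with hlt | hge
  · have h := coeff_euler k n x
    rw [he, map_zero] at h
    have hn0 : (n : k) ≠ 0 := fun h =>
      absurd (Nat.le_of_dvd hn ((CharP.cast_eq_zero_iff k p n).1 h)) (by omega)
    exact (smul_eq_zero.1 h.symm).resolve_left hn0
  · have := hp.pos
    exact coeff_eq_zero_of_mem_degreeLE k (by omega) hx

end PolyLie

section Cocycle

variable (k : Type*) [Field k] {N : Type*} [LieRing N] [LieAlgebra k N] {p : ℕ} (hp : p.Prime)
  [CharP k p]

open PolyLie

include hp

/-- Replacing x by Xx makes both sides polynomials of degree below p that vanish at X = 0. By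
`ad_jacobsonSum` their difference acts trivially on the Euler extension, hence is zero; then X = 1.
-/
theorem jacobsonSum_comm (x y : N) : jacobsonSum k p x y = jacobsonSum k p y x := by
  set a : PolyLie k N := mon k 1 x
  set b : PolyLie k N := mon k 0 y
  have ha : a ∈ degreeLE k N 1 := mon_mem_degreeLE k le_rfl x
  have hb : b ∈ degreeLE k N 0 := mon_mem_degreeLE k le_rfl y
  have h : jacobsonSum k p a b - jacobsonSum k p b a = 0 := by
    refine eq_zero_of_ad_eq_zero k hp ?_ ?_ ?_
    · exact sub_mem (jacobsonSum_mem_degreeLE_left k ha hb) (jacobsonSum_mem_degreeLE_right k hb ha)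
    · simp [map_jacobsonSum, a, jacobsonSum_zero_left k hp, jacobsonSum_zero_right k hp]
    · simp only [map_sub, map_jacobsonSum (f := EulerLie.inl k), ad_jacobsonSum k hp]
      rw [add_comm (EulerLie.inl k b)]; abel
  have := congrArg (eval k 1) h
  simpa [map_jacobsonSum, a, b, sub_eq_zero] using this

/-- Again only x receives the factor X. At X = 0 both sides reduce to the correction sum of y and z,
and under `ad` both become the p-th power of the sum minus the three p-th powers. -/
theorem jacobsonSum_cocycle (x y z : N) :
    jacobsonSum k p x y + jacobsonSum k p (x + y) z =
      jacobsonSum k p y z + jacobsonSum k p x (y + z) := by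
  set a : PolyLie k N := mon k 1 x
  set b : PolyLie k N := mon k 0 y
  set c : PolyLie k N := mon k 0 z
  have ha : a ∈ degreeLE k N 1 := mon_mem_degreeLE k le_rfl x
  have hb : b ∈ degreeLE k N 0 := mon_mem_degreeLE k le_rfl y
  have hc : c ∈ degreeLE k N 0 := mon_mem_degreeLE k le_rfl z
  have hb' : b ∈ degreeLE k N 1 := degreeLE_mono k zero_le_one hb
  have h : jacobsonSum k p a b + jacobsonSum k p (a + b) c -
      (jacobsonSum k p b c + jacobsonSum k p a (b + c)) = 0 := by
    refine eq_zero_of_ad_eq_zero k hp ?_ ?_ ?_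
    · exact sub_mem (add_mem (jacobsonSum_mem_degreeLE_left k ha hb)
        (jacobsonSum_mem_degreeLE_left k (add_mem ha hb') hc))
        (add_mem (jacobsonSum_mem_degreeLE_left k hb' hc)
        (jacobsonSum_mem_degreeLE_left k ha (add_mem hb hc)))
    · simp [map_jacobsonSum, a, jacobsonSum_zero_left k hp]
    · simp only [map_sub, map_add (EulerLie.inl k), map_add (LieAlgebra.ad k (EulerLie k N)),
        map_jacobsonSum (f := EulerLie.inl k), ad_jacobsonSum k hp]
      rw [add_assoc (LieAlgebra.ad k _ _)]; abel
  have := congrArg (eval k 1) h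
  simpa [map_jacobsonSum, a, b, c, sub_eq_zero] using this

end Cocycle

/-! ### Construction of `p`-maps -/

/-- The extension of `N` by its Frobenius twist given by Jacobson's cocycle. A restricted
structure on `N` is the same as a suitable linear section of it. -/
@[ext]
structure JacobsonExt (k : Type*) (p : ℕ) (N : Type*) where
  /-- The component in the quotient `N`. -/
  fst : N
  /-- The component in the Frobenius twist of `N`. -/
  snd : N

namespace JacobsonExt

section Operations

variable {k : Type*} {p : ℕ} {N : Type*}

instance [Zero N] : Zero (JacobsonExt k p N) := ⟨⟨0, 0⟩⟩

instance [Neg N] : Neg (JacobsonExt k p N) := ⟨fun a => ⟨-a.fst, -a.snd⟩⟩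

noncomputable instance [Field k] [LieRing N] [LieAlgebra k N] : Add (JacobsonExt k p N) :=
  ⟨fun a b => ⟨a.fst + b.fst, a.snd + b.snd + jacobsonSum k p a.fst b.fst⟩⟩

instance [Monoid k] [SMul k N] : SMul k (JacobsonExt k p N) :=
  ⟨fun c a => ⟨c • a.fst, c ^ p • a.snd⟩⟩

@[simp] theorem zero_fst [Zero N] : (0 : JacobsonExt k p N).fst = 0 := rfl
@[simp] theorem zero_snd [Zero N] : (0 : JacobsonExt k p N).snd = 0 := rfl
@[simp] theorem neg_fst [Neg N] (a : JacobsonExt k p N) : (-a).fst = -a.fst := rfl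
@[simp] theorem neg_snd [Neg N] (a : JacobsonExt k p N) : (-a).snd = -a.snd := rfl
@[simp] theorem add_fst [Field k] [LieRing N] [LieAlgebra k N] (a b : JacobsonExt k p N) :
    (a + b).fst = a.fst + b.fst := rfl
@[simp] theorem add_snd [Field k] [LieRing N] [LieAlgebra k N] (a b : JacobsonExt k p N) :
    (a + b).snd = a.snd + b.snd + jacobsonSum k p a.fst b.fst := rfl
@[simp] theorem smul_fst [Monoid k] [SMul k N] (c : k) (a : JacobsonExt k p N) :
    (c • a).fst = c • a.fst := rfl
@[simp] theorem smul_snd [Monoid k] [SMul k N] (c : k) (a : JacobsonExt k p N) :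
    (c • a).snd = c ^ p • a.snd := rfl

end Operations

variable {k : Type*} [Field k] {p : ℕ} [hp : Fact p.Prime] [CharP k p] {N N' : Type*} [LieRing N]
  [LieAlgebra k N] [LieRing N'] [LieAlgebra k N']

noncomputable instance : AddCommGroup (JacobsonExt k p N) where
  add_assoc a b c := by
    ext
    · simp [add_assoc]
    · have := jacobsonSum_cocycle k hp.out a.fst b.fst c.fst
      simp only [add_snd, add_fst]
      rw [add_assoc (a.snd + b.snd), add_comm (jacobsonSum k p a.fst b.fst), ← add_assoc,
        add_assoc _ _ (jacobsonSum k p (a.fst + b.fst) c.fst), ← sub_eq_zero]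
      rw [← sub_eq_zero] at this
      rw [← this]; abel
  zero_add a := by ext <;> simp [jacobsonSum_zero_left k hp.out]
  add_zero a := by ext <;> simp [jacobsonSum_zero_right k hp.out]
  add_comm a b := by
    ext
    · simp [add_comm]
    · simp only [add_snd]; rw [jacobsonSum_comm k hp.out, add_comm a.snd]
  neg_add_cancel a := by
    ext
    · simp
    · simp [jacobsonSum_eq_zero_of_lie_eq_zero k hp.out (a := -a.fst) (b := a.fst)]
  nsmul := nsmulRec
  zsmul := zsmulRec

noncomputable instance : Module k (JacobsonExt k p N) where
  one_smul a := by ext <;> simp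
  mul_smul c d a := by ext <;> simp [mul_smul, mul_pow]
  smul_zero c := by ext <;> simp
  zero_smul a := by ext <;> simp [zero_pow hp.out.ne_zero]
  smul_add c a b := by ext <;> simp [jacobsonSum_smul_smul k hp.out]
  add_smul c d a := by
    ext
    · simp [add_smul]
    -- Frobenius is additive on k, and multiples of one element commute, so the correction vanishes.
    · simp [add_pow_char c d p, add_smul,
        jacobsonSum_eq_zero_of_lie_eq_zero k hp.out (a := c • a.fst) (b := d • a.fst)]

/-- The functoriality of the extension. -/
noncomputable def map (f : N →ₗ⁅k⁆ N') : JacobsonExt k p N →ₗ[k] JacobsonExt k p N' where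
  toFun a := ⟨f a.fst, f a.snd⟩
  map_add' a b := by ext <;> simp [map_jacobsonSum]
  map_smul' c a := by ext <;> simp

/-- The pairs `(x, y)` with `ad y = (ad x) ^ p`. -/
noncomputable def adSubmodule (k : Type*) [Field k] (p : ℕ) [hp : Fact p.Prime] [CharP k p]
    (N : Type*) [LieRing N] [LieAlgebra k N] : Submodule k (JacobsonExt k p N) where
  carrier := {a | LieAlgebra.ad k N a.snd = LieAlgebra.ad k N a.fst ^ p}
  zero_mem' := by simp [zero_pow hp.out.ne_zero]
  add_mem' {a b} ha hb := by
    simp only [Set.mem_ofPred_eq, add_snd, add_fst] at *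
    rw [map_add, map_add, ad_jacobsonSum k hp.out, ha, hb]; abel
  smul_mem' c a ha := by
    simp only [Set.mem_ofPred_eq, smul_snd, smul_fst] at *
    rw [map_smul, map_smul, ha, smul_pow]

theorem mem_adSubmodule {a : JacobsonExt k p N} :
    a ∈ adSubmodule k p N ↔ ∀ z, ⁅a.snd, z⁆ = (LieAlgebra.ad k N a.fst ^ p) z :=
  LinearMap.ext_iff

/-- The restricted structure defined by a linear section. -/
noncomputable abbrev restricted (σ : N →ₗ[k] JacobsonExt k p N) (hfst : ∀ x, (σ x).fst = x)
    (had : ∀ x, σ x ∈ adSubmodule k p N) : RestrictedLieAlgebra k p N where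
  pMap x := (σ x).snd
  pMap_smul c x := by rw [map_smul, smul_snd]
  pMap_add x y := by rw [map_add, add_snd, hfst, hfst]; rfl
  ad_pMap x := by
    have : LieAlgebra.ad k N (σ x).snd = LieAlgebra.ad k N (σ x).fst ^ p := had x
    rwa [hfst] at this

/-- The linear section defined by a restricted structure. -/
noncomputable def ofRestricted (S : RestrictedLieAlgebra k p N) :
    N →ₗ[k] JacobsonExt k p N where
  toFun x := ⟨x, S.pMap x⟩
  map_add' x y := by
    ext
    · simp
    · simp [S.pMap_add x y, jacobsonSum]
  map_smul' c x := by
    ext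
    · simp
    · simp [S.pMap_smul c x]

end JacobsonExt

/-! ### Restricted structures on polynomials -/

namespace PolyLie

variable {k : Type*} [Field k] {p : ℕ} [hp : Fact p.Prime] [CharP k p] {N : Type*} [LieRing N]
  [LieAlgebra k N]

omit hp [CharP k p] in
theorem adBinom_mon (i l : ℕ) (a b x : N) (m j : ℕ) :
    adBinom k (mon k i a) (mon k i b) m j (mon k l x) =
      mon k (m * i + l) (adBinom k a b m j x) := by
  refine adBinom_induction (P := fun m j => adBinom k (mon k i a) (mon k i b) m j (mon k l x) =
      mon k (m * i + l) (adBinom k a b m j x)) ?_ ?_ ?_ ?_ m j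
  · simp [adBinom_zero_zero]
  · simp [adBinom_zero_succ]
  · intro m h
    rw [adBinom_succ_zero, h, lie_mon_mon, adBinom_succ_zero]
    congr 1; ring_nf
  · intro m j h h'
    rw [adBinom_succ_succ, h, h', lie_mon_mon, lie_mon_mon, adBinom_succ_succ, ← map_add]
    congr 1; ring_nf

-- Every term has p letters, so exponents are multiplied by p. This is what makes X^i ⊗ x ↦ X^(pi) ⊗
-- x^[p] compatible with Jacobson's formula.
omit [CharP k p] in
theorem jacobsonSum_mon (i : ℕ) (a b : N) :
    jacobsonSum k p (mon k i a) (mon k i b) = mon k (p * i) (jacobsonSum k p a b) := by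
  simp only [jacobsonSum, jacobsonS_eq_adBinom, adBinom_mon, map_sum, map_smul]
  refine Finset.sum_congr rfl fun j _ => ?_
  rw [← Nat.succ_mul, Nat.succ_eq_add_one, Nat.sub_add_cancel hp.out.one_le]

omit hp [CharP k p] in
theorem ad_mon_pow (i j : ℕ) (x y : N) (n : ℕ) :
    (LieAlgebra.ad k (PolyLie k N) (mon k i x) ^ n) (mon k j y) =
      mon k (n * i + j) ((LieAlgebra.ad k N x ^ n) y) := by
  induction n with
  | zero => simp
  | succ n ih =>
    rw [pow_succ', Module.End.mul_apply, ih, LieAlgebra.ad_apply, lie_mon_mon, pow_succ',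
      Module.End.mul_apply, LieAlgebra.ad_apply]
    congr 1; ring_nf

/-- The section `X ^ i ⊗ x ↦ (X ^ i ⊗ x, X ^ (p i) ⊗ x^[p])`. -/
noncomputable def jacobsonSection (S : RestrictedLieAlgebra k p N) :
    PolyLie k N →ₗ[k] JacobsonExt k p (PolyLie k N) :=
  lift k fun i =>
    { toFun x := ⟨mon k i x, mon k (p * i) (S.pMap x)⟩
      map_add' x y := by
        ext
        · simp
        · rw [JacobsonExt.add_snd, jacobsonSum_mon, ← map_add, ← map_add]
          exact congrArg (mon k (p * i)) (S.pMap_add x y)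
      map_smul' c x := by
        ext
        · simp
        · simp [S.pMap_smul c x] }

theorem jacobsonSection_mon (S : RestrictedLieAlgebra k p N) (i : ℕ) (x : N) :
    jacobsonSection S (mon k i x) = ⟨mon k i x, mon k (p * i) (S.pMap x)⟩ :=
  lift_mon k _ i x

theorem jacobsonSection_fst (S : RestrictedLieAlgebra k p N) (x : PolyLie k N) :
    (jacobsonSection S x).fst = x := by
  refine induction k (P := fun x => (jacobsonSection S x).fst = x) ?_ ?_ x
  · intro x y hx hy; rw [map_add, JacobsonExt.add_fst, hx, hy]
  · intro i x; rw [jacobsonSection_mon]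

/-- Membership in a submodule is linear in x, and the defining identity is linear in the element
acted on, so both may be taken to be monomials. -/
theorem jacobsonSection_mem (S : RestrictedLieAlgebra k p N) (x : PolyLie k N) :
    jacobsonSection S x ∈ JacobsonExt.adSubmodule k p (PolyLie k N) := by
  refine induction k
    (P := fun x => jacobsonSection S x ∈ JacobsonExt.adSubmodule k p (PolyLie k N)) ?_ ?_ x
  · intro x y hx hy; rw [map_add]; exact add_mem hx hy
  · intro i x
    rw [jacobsonSection_mon, JacobsonExt.mem_adSubmodule]
    intro z
    refine induction k (P := fun z => ⁅mon k (p * i) (S.pMap x), z⁆ =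
      (LieAlgebra.ad k (PolyLie k N) (mon k i x) ^ p) z) ?_ ?_ z
    · intro z w hz hw; rw [lie_add, map_add, hz, hw]
    · intro j y
      rw [lie_mon_mon, ad_mon_pow, ← S.ad_pMap, LieAlgebra.ad_apply]

/-- The restricted structure on the polynomials with coefficients in a restricted Lie algebra. -/
noncomputable abbrev restricted (S : RestrictedLieAlgebra k p N) :
    RestrictedLieAlgebra k p (PolyLie k N) :=
  JacobsonExt.restricted (jacobsonSection S) (jacobsonSection_fst S) (jacobsonSection_mem S)

theorem restricted_pMap_mon (S : RestrictedLieAlgebra k p N) (i : ℕ) (x : N) :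
    (restricted S).pMap (mon k i x) = mon k (p * i) (S.pMap x) :=
  congrArg JacobsonExt.snd (jacobsonSection_mon S i x)

/-- The p-map is not linear, but the claim is the second component of an equality of linear maps
into `JacobsonExt`, which is checked on monomials. -/
theorem eval_pMap (S : RestrictedLieAlgebra k p N) (x : PolyLie k N) :
    eval k 1 ((restricted S).pMap x) = S.pMap (eval k 1 x) := by
  have h : JacobsonExt.map (eval k 1) ∘ₗ jacobsonSection S =
      JacobsonExt.ofRestricted S ∘ₗ (eval k 1).toLinearMap := by
    refine linearMap_ext k fun i x => ?_
    change JacobsonExt.map (eval k 1) (jacobsonSection S (mon k i x)) =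
      JacobsonExt.ofRestricted S (eval k 1 (mon k i x))
    rw [jacobsonSection_mon]
    ext
    · rfl
    · simp [JacobsonExt.map, JacobsonExt.ofRestricted]
  exact congrArg JacobsonExt.snd (LinearMap.congr_fun h x)

end PolyLie

namespace EulerLie

variable {k : Type*} [Field k] {p : ℕ} [hp : Fact p.Prime] [CharP k p] {N : Type*} [LieRing N]
  [LieAlgebra k N]

/-- The section extending that of `k[X] ⊗ N` and sending the Euler derivation `d` to `(d, d)`. -/
noncomputable def jacobsonSection (S : RestrictedLieAlgebra k p N) :
    EulerLie k N →ₗ[k] JacobsonExt k p (EulerLie k N) :=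
  JacobsonExt.map (inl k) ∘ₗ PolyLie.jacobsonSection S ∘ₗ LieAlgebra.SemiDirectSum.projl _ +
    LinearMap.toSpanSingleton k _ ⟨inr k 1, inr k 1⟩ ∘ₗ
      (LieAlgebra.SemiDirectSum.projr (PolyLie.eulerAction k N)).toLinearMap

theorem jacobsonSection_apply (S : RestrictedLieAlgebra k p N) (x : EulerLie k N) :
    jacobsonSection S x = JacobsonExt.map (inl k) (PolyLie.jacobsonSection S x.left) +
      x.right • ⟨inr k 1, inr k 1⟩ := rfl

theorem jacobsonSection_fst (S : RestrictedLieAlgebra k p N) (x : EulerLie k N) :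
    (jacobsonSection S x).fst = x := by
  rw [jacobsonSection_apply, JacobsonExt.add_fst, JacobsonExt.smul_fst, ← map_smul]
  conv_rhs => rw [inl_add_inr k x]
  congr 1
  · exact congrArg (inl k) (PolyLie.jacobsonSection_fst S x.left)
  · simp

omit hp [CharP k p] in
theorem ad_inl_pow_inl (x y : PolyLie k N) (n : ℕ) :
    (LieAlgebra.ad k (EulerLie k N) (inl k x) ^ n) (inl k y) =
      inl k ((LieAlgebra.ad k (PolyLie k N) x ^ n) y) := by
  induction n with
  | zero => simp
  | succ n ih => rw [pow_succ', Module.End.mul_apply, ih, LieAlgebra.ad_apply, ← LieHom.map_lie,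
      pow_succ', Module.End.mul_apply, LieAlgebra.ad_apply]

omit hp [CharP k p] in
theorem lie_inr_inr (c d : k) : ⁅(inr k c : EulerLie k N), (inr k d : EulerLie k N)⁆ = 0 := by
  rw [← LieHom.map_lie, LieRing.of_associative_ring_bracket, mul_comm, sub_self, map_zero]

omit hp [CharP k p] in
theorem lie_inl_mon_inr (i : ℕ) (x : N) (c : k) :
    ⁅inl k (PolyLie.mon k i x), inr k c⁆ = -(c * i) • inl k (PolyLie.mon k i x) := by
  rw [← lie_skew, lie_inr_inl, PolyLie.euler_mon, smul_smul, map_smul, neg_smul]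

theorem mem_adSubmodule_inl (S : RestrictedLieAlgebra k p N) (x : PolyLie k N) :
    JacobsonExt.map (inl k) (PolyLie.jacobsonSection S x) ∈
      JacobsonExt.adSubmodule k p (EulerLie k N) := by
  refine PolyLie.induction k
    (P := fun x => JacobsonExt.map (inl k) (PolyLie.jacobsonSection S x) ∈
      JacobsonExt.adSubmodule k p (EulerLie k N)) ?_ ?_ x
  · intro x y hx hy; rw [map_add, map_add]; exact add_mem hx hy
  · intro i x
    rw [PolyLie.jacobsonSection_mon, JacobsonExt.mem_adSubmodule]
    intro z
    change ⁅inl k (PolyLie.mon k (p * i) (S.pMap x)), z⁆ =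
      (LieAlgebra.ad k (EulerLie k N) (inl k (PolyLie.mon k i x)) ^ p) z
    rw [inl_add_inr k z, lie_add, map_add]
    congr 1
    · have := JacobsonExt.mem_adSubmodule.1 (PolyLie.jacobsonSection_mem S (PolyLie.mon k i x))
        z.left
      rw [PolyLie.jacobsonSection_mon] at this
      rw [← LieHom.map_lie, ad_inl_pow_inl, this]
    -- On multiples of d both sides vanish: X^(pi) has weight pi = 0 in k, and two brackets with X^i
    -- ⊗ x already kill d.
    · rw [lie_inl_mon_inr]
      obtain ⟨n, hn⟩ := Nat.exists_eq_add_of_le' hp.out.two_le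
      rw [Nat.cast_mul, CharP.cast_eq_zero, zero_mul, mul_zero, neg_zero, zero_smul, hn, pow_add,
        Module.End.mul_apply, pow_two, Module.End.mul_apply, LieAlgebra.ad_apply,
        LieAlgebra.ad_apply, lie_inl_mon_inr, lie_smul, lie_self, smul_zero, map_zero]

/-- `ad d` is diagonalizable with eigenvalues in the prime field, which Frobenius fixes; hence (ad
d)^p = ad d. -/
theorem mem_adSubmodule_inr :
    (⟨inr k 1, inr k 1⟩ : JacobsonExt k p (EulerLie k N)) ∈
      JacobsonExt.adSubmodule k p (EulerLie k N) := by
  rw [JacobsonExt.mem_adSubmodule]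
  intro z
  change ⁅inr k 1, z⁆ = (LieAlgebra.ad k (EulerLie k N) (inr k 1) ^ p) z
  rw [inl_add_inr k z, lie_add, map_add]
  congr 1
  · refine PolyLie.induction k (P := fun x => ⁅inr k 1, inl k x⁆ =
      (LieAlgebra.ad k (EulerLie k N) (inr k 1) ^ p) (inl k x)) ?_ ?_ z.left
    · intro x y hx hy; rw [map_add, lie_add, map_add, hx, hy]
    · intro i x
      have h : ∀ n, (LieAlgebra.ad k (EulerLie k N) (inr k 1) ^ n) (inl k (PolyLie.mon k i x)) =
          (i : k) ^ n • inl k (PolyLie.mon k i x) := by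
        intro n
        induction n with
        | zero => simp
        | succ n ih =>
          rw [pow_succ', Module.End.mul_apply, ih, map_smul, LieAlgebra.ad_apply, lie_inr_inl,
            PolyLie.euler_mon, one_smul, map_smul, smul_smul, pow_succ]
      have hi : (i : k) ^ p = i := by rw [← frobenius_def, map_natCast]
      rw [h, hi, lie_inr_inl, one_smul, PolyLie.euler_mon, map_smul]
  · obtain ⟨n, hn⟩ := Nat.exists_eq_add_of_le' hp.out.one_le
    rw [hn, pow_succ, Module.End.mul_apply, LieAlgebra.ad_apply, lie_inr_inr, map_zero]

/-- The restricted structure on the semidirect sum. -/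
noncomputable abbrev restricted (S : RestrictedLieAlgebra k p N) :
    RestrictedLieAlgebra k p (EulerLie k N) :=
  JacobsonExt.restricted (jacobsonSection S) (jacobsonSection_fst S) fun x => by
    rw [jacobsonSection_apply]
    exact add_mem (mem_adSubmodule_inl S _) (Submodule.smul_mem _ _ mem_adSubmodule_inr)

theorem restricted_pMap_inl (S : RestrictedLieAlgebra k p N) (x : PolyLie k N) :
    (restricted S).pMap (inl k x) = inl k ((PolyLie.restricted S).pMap x) := by
  change (jacobsonSection S (inl k x)).snd = _
  rw [jacobsonSection_apply]
  change (_ + (0 : k) • _ : JacobsonExt k p (EulerLie k N)).snd = _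
  rw [zero_smul, add_zero]; rfl

theorem restricted_pMap_inr (S : RestrictedLieAlgebra k p N) (c : k) :
    (restricted S).pMap (inr k c) = inr k (c ^ p) := by
  change (jacobsonSection S (inr k c)).snd = _
  rw [jacobsonSection_apply]
  change (JacobsonExt.map (inl k) (PolyLie.jacobsonSection S 0) + c • _ :
    JacobsonExt k p (EulerLie k N)).snd = _
  rw [map_zero, map_zero, zero_add, JacobsonExt.smul_snd, ← map_smul, smul_eq_mul, mul_one]

end EulerLie

/-! ### Examples of restricted Lie algebras -/

section Restricted

variable (k : Type*) [Field k] (p : ℕ) [hp : Fact p.Prime]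

/-- An associative algebra in characteristic `p`, with the `p`-map `x ↦ x ^ p`. -/
abbrev RestrictedLieAlgebra.ofAssociative [CharP k p] (A : Type*) [Ring A] [Algebra k A] :
    RestrictedLieAlgebra k p A where
  pMap x := x ^ p
  pMap_smul c x := smul_pow c x p
  pMap_add x y := add_pow_char_eq_jacobsonSum k hp.out x y
  ad_pMap x := ad_pow_char k hp.out x

/-- An abelian Lie algebra with the zero `p`-map. -/
abbrev RestrictedLieAlgebra.ofAbelian (N : Type*) [LieRing N] [LieAlgebra k N]
    (h : ∀ x y : N, ⁅x, y⁆ = 0) : RestrictedLieAlgebra k p N where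
  pMap _ := 0
  pMap_smul c x := (smul_zero _).symm
  pMap_add x y := by
    have := jacobsonSum_eq_zero_of_lie_eq_zero k hp.out (h x y)
    rw [jacobsonSum] at this
    rw [this, add_zero, add_zero]
  ad_pMap x := by
    have : LieAlgebra.ad k N x = 0 := LinearMap.ext (h x)
    rw [this, map_zero, zero_pow hp.out.ne_zero]

variable {k p}

theorem RestrictedLieAlgebra.pMap_add_of_lie_eq_zero {N : Type*} [LieRing N] [LieAlgebra k N]
    (S : RestrictedLieAlgebra k p N) {x y : N} (h : ⁅x, y⁆ = 0) :
    S.pMap (x + y) = S.pMap x + S.pMap y := by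
  have := jacobsonSum_eq_zero_of_lie_eq_zero k hp.out h
  rw [jacobsonSum] at this
  rw [S.pMap_add, this, add_zero]

theorem RestrictedLieAlgebra.map_zero {N : Type*} [LieRing N] [LieAlgebra k N]
    (S : RestrictedLieAlgebra k p N) : S.pMap 0 = 0 := by
  have h := S.pMap_smul (0 : k) 0
  rwa [zero_smul, zero_pow hp.out.ne_zero, zero_smul] at h

variable {N N' : Type*} [LieRing N] [LieAlgebra k N] [LieRing N'] [LieAlgebra k N']

/-- The product of two restricted Lie algebras. -/
abbrev RestrictedLieAlgebra.prod (S : RestrictedLieAlgebra k p N)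
    (S' : RestrictedLieAlgebra k p N') : RestrictedLieAlgebra k p (N × N') where
  pMap x := (S.pMap x.1, S'.pMap x.2)
  pMap_smul c x := by rw [Prod.smul_fst, Prod.smul_snd, S.pMap_smul, S'.pMap_smul]; rfl
  pMap_add x y := by
    have h1 := map_jacobsonSum k (LieHom.fst k N N') p x y
    have h2 := map_jacobsonSum k (LieHom.snd k N N') p x y
    exact Prod.ext ((S.pMap_add x.1 y.1).trans (congrArg _ h1.symm))
      ((S'.pMap_add x.2 y.2).trans (congrArg _ h2.symm))
  ad_pMap x := by
    have h : ∀ (n : ℕ) (z : N × N'), (LieAlgebra.ad k (N × N') x ^ n) z =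
        ((LieAlgebra.ad k N x.1 ^ n) z.1, (LieAlgebra.ad k N' x.2 ^ n) z.2) := by
      intro n
      induction n with
      | zero => intro z; rfl
      | succ n ih =>
        intro z
        simp only [pow_succ', Module.End.mul_apply, ih]; rfl
    ext1 <;> ext z <;> simp [h, ← S.ad_pMap, ← S'.ad_pMap]

end Restricted

/-! ### Lie algebras with an optional restricted structure -/

/-- The parameters of a category of Lie algebras over `k`, which are restricted if `R` holds: in
that case `p` is the characteristic of `k`. -/
class RestrictedParam (R : Prop) (k : Type u) [Field k] (p : ℕ) : Prop where
  prime : R → p.Prime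
  charP : R → CharP k p

/-- Lie algebras over `k`, restricted if `R` holds. -/
structure OptRestrictedLie (R : Prop) (k : Type u) [Field k] (p : ℕ) : Type (max u (w + 1)) where
  /-- The underlying type. -/
  carrier : Type w
  [lieRing : LieRing carrier]
  [lieAlgebra : LieAlgebra k carrier]
  /-- The restricted structure. -/
  str : R → RestrictedLieAlgebra k p carrier

namespace OptRestrictedLie

attribute [instance] lieRing lieAlgebra

variable {R : Prop} {k : Type u} [Field k] {p : ℕ}

/-- Homomorphisms of Lie algebras, commuting with the `p`-maps if `R` holds. -/
structure Hom (L M : OptRestrictedLie.{u, w} R k p) : Type w where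
  /-- The underlying Lie algebra homomorphism. -/
  hom : L.carrier →ₗ⁅k⁆ M.carrier
  map_pMap : ∀ (h : R) (x : L.carrier), hom ((L.str h).pMap x) = (M.str h).pMap (hom x)

namespace Hom

/-- The composition of homomorphisms. -/
def comp {L M N : OptRestrictedLie.{u, w} R k p} (g : Hom M N) (f : Hom L M) : Hom L N where
  hom := g.hom.comp f.hom
  map_pMap h x := by
    rw [LieHom.comp_apply, f.map_pMap, g.map_pMap, LieHom.comp_apply]

/-- The identity. -/
def id (L : OptRestrictedLie.{u, w} R k p) : Hom L L where
  hom := LieHom.id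
  map_pMap _ _ := rfl

theorem ext' {L M : OptRestrictedLie.{u, w} R k p} {f g : Hom L M}
    (h : ∀ x, f.hom x = g.hom x) : f = g := by
  have : f.hom = g.hom := LieHom.ext h
  cases f; cases g; cases this; rfl

end Hom

variable [hR : RestrictedParam R k p]

/-- The zero homomorphism. -/
def zeroHom (L M : OptRestrictedLie.{u, w} R k p) : Hom L M where
  hom := 0
  map_pMap h x := by
    have := Fact.mk (hR.prime h)
    exact ((M.str h).map_zero).symm

/-- The product. -/
noncomputable def prod (L M : OptRestrictedLie.{u, w} R k p) : OptRestrictedLie.{u, w} R k p where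
  carrier := L.carrier × M.carrier
  str h := have := Fact.mk (hR.prime h); (L.str h).prod (M.str h)

/-- The first projection. -/
noncomputable def fst (L M : OptRestrictedLie.{u, w} R k p) : Hom (prod L M) L where
  hom := LieHom.fst k L.carrier M.carrier
  map_pMap _ _ := rfl

/-- The second projection. -/
noncomputable def snd (L M : OptRestrictedLie.{u, w} R k p) : Hom (prod L M) M where
  hom := LieHom.snd k L.carrier M.carrier
  map_pMap _ _ := rfl

/-- The pairing of two homomorphisms. -/
noncomputable def pair {L M N : OptRestrictedLie.{u, w} R k p} (f : Hom L M) (g : Hom L N) :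
    Hom L (prod M N) where
  hom := LieHom.prod f.hom g.hom
  map_pMap h x := Prod.ext (f.map_pMap h x) (g.map_pMap h x)

/-- The homomorphism from a product given by two commuting homomorphisms. -/
noncomputable def coprod {L M N : OptRestrictedLie.{u, w} R k p} (f : Hom L N) (g : Hom M N)
    (hfg : ∀ x y, ⁅f.hom x, g.hom y⁆ = 0) : Hom (prod L M) N where
  hom :=
    { __ := LinearMap.coprod f.hom.toLinearMap g.hom.toLinearMap
      map_lie' := fun {x y} => by
        change f.hom ⁅x.1, y.1⁆ + g.hom ⁅x.2, y.2⁆ =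
          ⁅f.hom x.1 + g.hom x.2, f.hom y.1 + g.hom y.2⁆
        rw [add_lie, lie_add, lie_add, hfg, ← lie_skew (g.hom x.2), hfg, LieHom.map_lie,
          LieHom.map_lie, neg_zero, add_zero, zero_add] }
  map_pMap h x := by
    have := Fact.mk (hR.prime h)
    change f.hom ((L.str h).pMap x.1) + g.hom ((M.str h).pMap x.2) =
      (N.str h).pMap (f.hom x.1 + g.hom x.2)
    rw [(N.str h).pMap_add_of_lie_eq_zero (hfg _ _), f.map_pMap, g.map_pMap]

theorem coprod_apply {L M N : OptRestrictedLie.{u, w} R k p} (f : Hom L N) (g : Hom M N)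
    (hfg : ∀ x y, ⁅f.hom x, g.hom y⁆ = 0) (x : L.carrier) (y : M.carrier) :
    (coprod f g hfg).hom (x, y) = f.hom x + g.hom y := rfl

variable (R k p) in
/-- The Lie algebra of an associative algebra. -/
def ofAlgebra (A : Type w) [Ring A] [Algebra k A] : OptRestrictedLie.{u, w} R k p where
  carrier := A
  lieRing := LieRing.ofAssociativeRing
  lieAlgebra := LieAlgebra.ofAssociativeAlgebra
  str h :=
    have := Fact.mk (hR.prime h)
    have := hR.charP h
    RestrictedLieAlgebra.ofAssociative k p A

/-- The homomorphism given by a multiplicative linear map. -/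
def ofMul {A B : Type w} [Ring A] [Algebra k A] [Ring B] [Algebra k B] (f : A →ₗ[k] B)
    (hf : ∀ x y, f (x * y) = f x * f y) : Hom (ofAlgebra R k p A) (ofAlgebra R k p B) where
  hom :=
    { __ := f
      map_lie' := fun {x y} =>
        have h : ∀ x y : A, f (x * y - y * x) = f x * f y - f y * f x := fun x y => by
          rw [map_sub, hf, hf]
        h x y }
  map_pMap h := by
    change ∀ x : A, f (x ^ p) = f x ^ p
    intro x
    obtain ⟨n, hn⟩ := Nat.exists_eq_add_of_le' (hR.prime h).one_le
    rw [hn]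
    clear hn
    induction n with
    | zero => simp
    | succ n ih => rw [pow_succ, hf, ih, ← pow_succ]

/-- The values of a homomorphism to the Lie algebra of an associative algebra. -/
def Hom.val {L : OptRestrictedLie.{u, w} R k p} {A : Type w} [Ring A] [Algebra k A]
    (f : Hom L (ofAlgebra R k p A)) (l : L.carrier) : A := f.hom l

/-- The adjoint representation. -/
def adHom (M : OptRestrictedLie.{u, w} R k p) :
    Hom M (ofAlgebra R k p (Module.End k M.carrier)) where
  hom := LieAlgebra.ad k M.carrier
  map_pMap h x := (M.str h).ad_pMap x

variable (R k p) in
/-- The one-dimensional Lie algebra with the zero `p`-map. -/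
def nilLine : OptRestrictedLie.{u, max u v} R k p where
  carrier := ULift.{v} k
  lieRing := LieRing.ofAssociativeRing
  lieAlgebra := LieAlgebra.ofAssociativeAlgebra
  str h :=
    have := Fact.mk (hR.prime h)
    RestrictedLieAlgebra.ofAbelian k p (ULift.{v} k) fun x y => by
      rw [LieRing.of_associative_ring_bracket, mul_comm, sub_self]

variable (R k p) in
/-- The one-dimensional Lie algebra with the `p`-map `x ↦ x ^ p`. -/
def torLine : OptRestrictedLie.{u, max u v} R k p := ofAlgebra R k p (ULift.{v} k)

/-! ### Homomorphisms out of the one-dimensional test algebras -/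

section Line

variable {M : OptRestrictedLie.{u, max u v} R k p} (y : M.carrier)

/-- The linear map sending the generator of a line to `y`, as a Lie algebra homomorphism. -/
def lineLieHom : ULift.{v} k →ₗ⁅k⁆ M.carrier where
  __ := (LinearMap.toSpanSingleton k M.carrier y) ∘ₗ (ULift.moduleEquiv (R := k)).toLinearMap
  map_lie' {a b} := by
    change (a.down * b.down - b.down * a.down) • y = ⁅a.down • y, b.down • y⁆
    rw [mul_comm, sub_self, zero_smul, smul_lie, lie_smul, lie_self, smul_zero, smul_zero]

/-- The homomorphism from `nilLine` given by an element with zero `p`-map. -/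
def nilHom (hy : ∀ h, (M.str h).pMap y = 0) : Hom (nilLine.{u, v} R k p) M where
  hom := lineLieHom y
  map_pMap h a := by
    change (0 : k) • y = (M.str h).pMap (a.down • y)
    rw [(M.str h).pMap_smul, hy, zero_smul, smul_zero]

/-- The homomorphism from `torLine` given by an element fixed by the `p`-map. -/
def torHom (hy : ∀ h, (M.str h).pMap y = y) : Hom (torLine.{u, v} R k p) M where
  hom := lineLieHom y
  map_pMap h a := by
    change (a.down ^ p) • y = (M.str h).pMap (a.down • y)
    rw [(M.str h).pMap_smul, hy]

end Line

/-- The polynomials with coefficients in `M`. -/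
noncomputable def poly (M : OptRestrictedLie.{u, max u v} R k p) :
    OptRestrictedLie.{u, max u v} R k p where
  carrier := PolyLie k M.carrier
  str h :=
    have := Fact.mk (hR.prime h)
    have := hR.charP h
    PolyLie.restricted (M.str h)

/-- The polynomials with coefficients in `M`, extended by the Euler derivation. -/
noncomputable def euler (M : OptRestrictedLie.{u, max u v} R k p) :
    OptRestrictedLie.{u, max u v} R k p where
  carrier := EulerLie k M.carrier
  str h :=
    have := Fact.mk (hR.prime h)
    have := hR.charP h
    EulerLie.restricted (M.str h)

/-- The inclusion of the constants. -/
noncomputable def polyConst (M : OptRestrictedLie.{u, max u v} R k p) : Hom M (poly M) where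
  hom := PolyLie.const k
  map_pMap h x := by
    have := Fact.mk (hR.prime h)
    have := hR.charP h
    exact (PolyLie.restricted_pMap_mon (M.str h) 0 x).symm

/-- Evaluation at `1`. -/
noncomputable def polyEval (M : OptRestrictedLie.{u, max u v} R k p) : Hom (poly M) M where
  hom := PolyLie.eval k 1
  map_pMap h x := by
    have := Fact.mk (hR.prime h)
    have := hR.charP h
    exact PolyLie.eval_pMap (M.str h) x

/-- The inclusion of the polynomials. -/
noncomputable def eulerInl (M : OptRestrictedLie.{u, max u v} R k p) : Hom (poly M) (euler M) where
  hom := EulerLie.inl k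
  map_pMap h x := by
    have := Fact.mk (hR.prime h)
    have := hR.charP h
    exact (EulerLie.restricted_pMap_inl (M.str h) x).symm

/-! ### Natural endomorphisms -/

omit hR in
/-- A natural choice of an endomorphism of `M` for every homomorphism `L → M`. -/
structure NatEndo (L : OptRestrictedLie.{u, w} R k p) where
  /-- The endomorphism of the target of a homomorphism. -/
  app : ∀ {M : OptRestrictedLie.{u, w} R k p}, Hom L M → Hom M M
  naturality : ∀ {M N : OptRestrictedLie.{u, w} R k p} (f : Hom L M) (g : Hom M N) (x : M.carrier),
    (app (g.comp f)).hom (g.hom x) = g.hom ((app f).hom x)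

namespace NatEndo

section General

variable {L : OptRestrictedLie.{u, w} R k p} (η : NatEndo L)

omit hR in
theorem naturality' {M N : OptRestrictedLie.{u, w} R k p} (f : Hom L M) (g : Hom M N)
    (h : Hom L N) (hh : ∀ l, h.hom l = g.hom (f.hom l)) (x : M.carrier) :
    (η.app h).hom (g.hom x) = g.hom ((η.app f).hom x) := by
  have : h = g.comp f := Hom.ext' hh
  rw [this, η.naturality]

/-- For (f, id) : L → M × L the two projections force η to send (x, 0) to (η x, 0). The homomorphism
φ + g on M × L, defined because the images commute, carries this to N. -/
theorem app_of_commute {M N : OptRestrictedLie.{u, w} R k p} (f : Hom L M) (φ : Hom M N)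
    (g h : Hom L N) (hg : ∀ x l, ⁅φ.hom x, g.hom l⁆ = 0)
    (hh : ∀ l, h.hom l = φ.hom (f.hom l) + g.hom l) (x : M.carrier) :
    (η.app h).hom (φ.hom x) = φ.hom ((η.app f).hom x) := by
  have h1 := η.naturality' (pair f (Hom.id L)) (coprod φ g hg) h (fun l => hh l) (x, 0)
  have h2 := η.naturality' (pair f (Hom.id L)) (fst M L) f (fun _ => by rfl) (x, 0)
  have h3 := η.naturality' (pair f (Hom.id L)) (snd M L) (Hom.id L) (fun _ => by rfl) (x, 0)
  set z := (η.app (pair f (Hom.id L))).hom (x, 0)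
  have h2' : z.1 = (η.app f).hom x := h2.symm
  have h3' : z.2 = 0 := h3.symm.trans (map_zero (η.app (Hom.id L)).hom)
  have hx : (coprod φ g hg).hom (x, 0) = φ.hom x := by
    rw [coprod_apply, map_zero, add_zero]
  rw [hx] at h1
  rw [h1]
  change φ.hom z.1 + g.hom z.2 = _
  rw [h2', h3', map_zero, add_zero]

end General

/-! ### Action on elements commuting with the image of L -/

variable {L : OptRestrictedLie.{u, max u v} R k p} (η : NatEndo L)

/-- The scalar by which `η` acts on central elements with zero `p`-map. -/
noncomputable def nilScalar : k :=
  ((η.app (zeroHom L (nilLine.{u, v} R k p))).hom (ULift.up (1 : k) : ULift.{v} k) :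
    ULift.{v} k).down

/-- The scalar by which `η` acts on central elements fixed by the `p`-map. -/
noncomputable def torScalar : k :=
  ((η.app (zeroHom L (torLine.{u, v} R k p))).hom (ULift.up (1 : k) : ULift.{v} k) :
    ULift.{v} k).down

/-- Write f as 0 + f, where the first summand factors through the line mapping onto the span of y;
`app_of_commute` reduces the claim to that line. -/
theorem app_nil {M : OptRestrictedLie.{u, max u v} R k p} (f : Hom L M) (y : M.carrier)
    (hy : ∀ h, (M.str h).pMap y = 0) (hf : ∀ l, ⁅y, f.hom l⁆ = 0) :
    (η.app f).hom y = η.nilScalar • y := by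
  have h := η.app_of_commute (zeroHom L (nilLine.{u, v} R k p)) (nilHom y hy) f f
    (fun a l => by
      change ⁅a.down • y, f.hom l⁆ = 0
      rw [smul_lie, hf, smul_zero])
    (fun l => by
      change f.hom l = (0 : k) • y + f.hom l
      rw [zero_smul, zero_add]) (ULift.up (1 : k) : ULift.{v} k)
  change (η.app f).hom ((1 : k) • y) = η.nilScalar • y at h
  rwa [one_smul] at h

theorem app_tor {M : OptRestrictedLie.{u, max u v} R k p} (f : Hom L M) (y : M.carrier)
    (hy : ∀ h, (M.str h).pMap y = y) (hf : ∀ l, ⁅y, f.hom l⁆ = 0) :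
    (η.app f).hom y = η.torScalar • y := by
  have h := η.app_of_commute (zeroHom L (torLine.{u, v} R k p)) (torHom y hy) f f
    (fun a l => by
      change ⁅a.down • y, f.hom l⁆ = 0
      rw [smul_lie, hf, smul_zero])
    (fun l => by
      change f.hom l = (0 : k) • y + f.hom l
      rw [zero_smul, zero_add]) (ULift.up (1 : k) : ULift.{v} k)
  change (η.app f).hom ((1 : k) • y) = η.torScalar • y at h
  rwa [one_smul] at h

section Algebra

variable {A : Type (max u v)} [Ring A] [Algebra k A] (f : Hom L (ofAlgebra R k p A))

/-- The action of `η` on an associative algebra. -/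
def endo : A →ₗ[k] A := (η.app f).hom.toLinearMap

theorem endo_of_mul_self_eq_zero (y : A) (hy : y * y = 0) (hf : ∀ l, Commute y (f.val l)) :
    η.endo f y = η.nilScalar • y := by
  refine η.app_nil f y (fun h => ?_) fun l => ?_
  · change y ^ p = 0
    obtain ⟨n, hn⟩ := Nat.exists_eq_add_of_le' (hR.prime h).two_le
    rw [hn, pow_add, pow_two, hy, mul_zero]
  · change y * f.val l - f.val l * y = 0
    rw [hf, sub_self]

theorem endo_of_mul_self_eq_self (y : A) (hy : y * y = y) (hf : ∀ l, Commute y (f.val l)) :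
    η.endo f y = η.torScalar • y := by
  refine η.app_tor f y (fun h => ?_) fun l => ?_
  · exact IsIdempotentElem.pow_eq (show IsIdempotentElem y from hy) (hR.prime h).ne_zero
  · change y * f.val l - f.val l * y = 0
    rw [hf, sub_self]

theorem endo_commutator (x y : A) :
    η.endo f (x * y - y * x) = η.endo f x * η.endo f y - η.endo f y * η.endo f x :=
  LieHom.map_lie (η.app f).hom x y

end Algebra

-- Under the zero homomorphism every matrix commutes with L. With c and t the nil and toral scalars,
-- [E01, E12] = E02 gives c² = c, and [E01, E10] = E00 - E11 gives t = c².
open Matrix in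
theorem scalars_eq : η.nilScalar * η.nilScalar = η.nilScalar ∧ η.torScalar = η.nilScalar := by
  let f := zeroHom L (ofAlgebra R k p (Matrix (Fin 3) (Fin 3) (ULift.{v} k)))
  have hf : ∀ (y : Matrix (Fin 3) (Fin 3) (ULift.{v} k)) (l), Commute y (f.val l) :=
    fun y l => Commute.zero_right y
  have hn : ∀ i j : Fin 3, i ≠ j → η.endo f (single i j 1) =
      η.nilScalar • (single i j 1 :
      Matrix (Fin 3) (Fin 3) (ULift.{v} k)) := fun i j hij =>
    η.endo_of_mul_self_eq_zero f _ (single_mul_single_of_ne _ _ _ _ hij.symm _) (hf _)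
  have ht : ∀ i : Fin 3, η.endo f (single i i 1) = η.torScalar • (single i i 1 :
      Matrix (Fin 3) (Fin 3) (ULift.{v} k)) :=
    fun i => η.endo_of_mul_self_eq_self f _
      ((single_mul_single_same _ _ _ _ _).trans (by rw [mul_one])) (hf _)
  have h1 := η.endo_commutator f (single 0 1 1) (single 1 2 1)
  have h2 := η.endo_commutator f (single 0 1 1) (single 1 0 1)
  have e1 : (single 0 1 1 * single 1 2 1 - single 1 2 1 * single 0 1 1 :
      Matrix (Fin 3) (Fin 3) (ULift.{v} k)) = single 0 2 1 := by
    simp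
  have e2 : (single 0 1 1 * single 1 0 1 - single 1 0 1 * single 0 1 1 :
      Matrix (Fin 3) (Fin 3) (ULift.{v} k)) =
    single 0 0 1 - single 1 1 1 := by simp
  rw [e1, hn 0 1 (by decide), hn 1 2 (by decide), hn 0 2 (by decide), smul_mul_smul_comm,
    smul_mul_smul_comm, ← smul_sub, e1] at h1
  rw [e2, map_sub, ht, ht, ← smul_sub, hn 0 1 (by decide), hn 1 0 (by decide),
    smul_mul_smul_comm, smul_mul_smul_comm, ← smul_sub, e2] at h2
  have h1' := congrArg (fun X : Matrix (Fin 3) (Fin 3) (ULift.{v} k) => (X 0 2).down) h1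
  have h2' := congrArg (fun X : Matrix (Fin 3) (Fin 3) (ULift.{v} k) => (X 0 0).down) h2
  simp at h1' h2'
  exact ⟨h1'.symm, h2'.trans h1'.symm⟩

/-- The image of the Euler derivation. -/
theorem app_inr {M : OptRestrictedLie.{u, max u v} R k p} (f : Hom L M) :
    (η.app ((eulerInl M).comp ((polyConst M).comp f))).hom
      (EulerLie.inr k 1 : EulerLie k M.carrier) =
      η.torScalar • (EulerLie.inr k 1 : EulerLie k M.carrier) := by
  refine η.app_tor (M := euler M) _ (EulerLie.inr k 1 : EulerLie k M.carrier)
    (fun h => ?_) fun l => ?_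
  · have := Fact.mk (hR.prime h)
    have := hR.charP h
    refine (EulerLie.restricted_pMap_inr (M.str h) 1).trans ?_
    rw [one_pow]
  · change ⁅(EulerLie.inr k 1 : EulerLie k M.carrier),
      EulerLie.inl k (PolyLie.mon k 0 (f.hom l))⁆ = 0
    rw [EulerLie.lie_inr_inl, PolyLie.euler_mon, Nat.cast_zero, zero_smul, smul_zero, map_zero]

theorem app_inl {M : OptRestrictedLie.{u, max u v} R k p} (f : Hom L M) (x : PolyLie k M.carrier) :
    (η.app ((eulerInl M).comp ((polyConst M).comp f))).hom (EulerLie.inl k x) =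
      EulerLie.inl k ((η.app ((polyConst M).comp f)).hom x) :=
  η.naturality _ (eulerInl M) x

/-- L lands in the constants, so evaluation at 1 is a morphism under L. It allows x to be replaced
by Xx, on which the Euler derivation acts as the identity. -/
theorem eval_app {M : OptRestrictedLie.{u, max u v} R k p} (f : Hom L M) (x : M.carrier) :
    (η.app f).hom x = PolyLie.eval k 1 ((η.app ((polyConst M).comp f)).hom (PolyLie.mon k 1 x)) := by
  have h := η.naturality' ((polyConst M).comp f) (polyEval M) f
    (fun l => by
      change f.hom l = PolyLie.eval k 1 (PolyLie.mon k 0 (f.hom l))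
      simp) (PolyLie.mon k 1 x)
  change (η.app f).hom (PolyLie.eval k 1 (PolyLie.mon k 1 x)) = _ at h
  rw [PolyLie.eval_mon, one_pow, one_smul] at h
  exact h

omit hR in
theorem lie_inr_inl_mon_one (M : OptRestrictedLie.{u, max u v} R k p) (x : M.carrier) :
    ⁅(EulerLie.inr k 1 : EulerLie k M.carrier), EulerLie.inl k (PolyLie.mon k 1 x)⁆ =
      EulerLie.inl k (PolyLie.mon k 1 x) := by
  rw [EulerLie.lie_inr_inl, PolyLie.euler_mon, Nat.cast_one, one_smul, one_smul]

/-- η kills d, hence also Xx = [d, Xx]. -/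
theorem app_eq_zero (h0 : η.torScalar = 0) {M : OptRestrictedLie.{u, max u v} R k p} (f : Hom L M)
    (x : M.carrier) : (η.app f).hom x = 0 := by
  have h : (η.app ((eulerInl M).comp ((polyConst M).comp f))).hom
      (EulerLie.inl k (PolyLie.mon k 1 x)) = (0 : EulerLie k M.carrier) := by
    rw [← lie_inr_inl_mon_one M x]
    refine (LieHom.map_lie (η.app ((eulerInl M).comp ((polyConst M).comp f))).hom _ _).trans ?_
    rw [app_inr, h0, zero_smul]
    exact zero_lie _
  rw [app_inl] at h
  have h' : (η.app ((polyConst M).comp f)).hom (PolyLie.mon k 1 x) = (0 : PolyLie k M.carrier) :=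
    EulerLie.inl_injective k (h.trans (map_zero (EulerLie.inl k)).symm)
  rw [eval_app, h']
  exact map_zero (PolyLie.eval k 1)

/-- If `η` is the identity up to central elements, then it is the identity. -/
theorem app_eq_self (h1 : η.torScalar = 1)
    (hc : ∀ {M : OptRestrictedLie.{u, max u v} R k p} (f : Hom L M) (x y : M.carrier),
      ⁅y, (η.app f).hom x⁆ = ⁅y, x⁆)
    {M : OptRestrictedLie.{u, max u v} R k p} (f : Hom L M) (x : M.carrier) :
    (η.app f).hom x = x := by
  have h : (η.app ((eulerInl M).comp ((polyConst M).comp f))).hom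
      (EulerLie.inl k (PolyLie.mon k 1 x)) = EulerLie.inl k (PolyLie.mon k 1 x) := by
    -- Apply η to Xx = [d, Xx]: the factor d is fixed, and `hc` removes η from the other factor.
    conv_lhs => rw [← lie_inr_inl_mon_one M x]
    refine (LieHom.map_lie (η.app ((eulerInl M).comp ((polyConst M).comp f))).hom _ _).trans ?_
    rw [app_inr, h1, one_smul]
    refine Eq.trans ?_ (lie_inr_inl_mon_one M x)
    exact hc (M := euler M) _ (EulerLie.inl k (PolyLie.mon k 1 x))
      (EulerLie.inr k 1 : EulerLie k M.carrier)
  rw [app_inl] at h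
  have h' : (η.app ((polyConst M).comp f)).hom (PolyLie.mon k 1 x) =
      (PolyLie.mon k 1 x : PolyLie k M.carrier) :=
    EulerLie.inl_injective k h
  rw [eval_app, h', PolyLie.eval_mon, one_pow, one_smul]

end NatEndo

end OptRestrictedLie

/-! ### The restricted enveloping algebra -/

namespace OptRestrictedLie

variable {R : Prop} {k : Type u} [Field k] {p : ℕ} [hR : RestrictedParam R k p]

section Enveloping

variable (L : OptRestrictedLie.{u, max u v} R k p)

/-- The relations `ι x ^ p = ι (x^[p])` in the enveloping algebra. -/
inductive EnvelopingRel : UniversalEnvelopingAlgebra k L.carrier →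
    UniversalEnvelopingAlgebra k L.carrier → Prop
  | pMap (h : R) (x : L.carrier) : EnvelopingRel
      (UniversalEnvelopingAlgebra.ι k ((L.str h).pMap x)) (UniversalEnvelopingAlgebra.ι k x ^ p)

/-- The universal enveloping algebra of a Lie algebra, or the restricted enveloping algebra if `R`
holds. -/
abbrev Enveloping : Type (max u v) := RingQuot (EnvelopingRel L)

/-- The canonical map to the enveloping algebra. -/
noncomputable def envelopingHom : Hom L (ofAlgebra R k p (Enveloping L)) where
  hom :=
    { __ := (RingQuot.mkAlgHom k (EnvelopingRel L)).toLinearMap ∘ₗ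
        (UniversalEnvelopingAlgebra.ι k : L.carrier →ₗ⁅k⁆ _).toLinearMap
      map_lie' := fun {x y} => by
        change RingQuot.mkAlgHom k (EnvelopingRel L) (UniversalEnvelopingAlgebra.ι k ⁅x, y⁆) =
          RingQuot.mkAlgHom k (EnvelopingRel L) (UniversalEnvelopingAlgebra.ι k x) *
          RingQuot.mkAlgHom k (EnvelopingRel L) (UniversalEnvelopingAlgebra.ι k y) -
          RingQuot.mkAlgHom k (EnvelopingRel L) (UniversalEnvelopingAlgebra.ι k y) *
          RingQuot.mkAlgHom k (EnvelopingRel L) (UniversalEnvelopingAlgebra.ι k x)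
        rw [LieHom.map_lie, LieRing.of_associative_ring_bracket, map_sub, map_mul, map_mul] }
  map_pMap h x := by
    change RingQuot.mkAlgHom k (EnvelopingRel L) (UniversalEnvelopingAlgebra.ι k _) =
      RingQuot.mkAlgHom k (EnvelopingRel L) (UniversalEnvelopingAlgebra.ι k x) ^ p
    rw [← map_pow]
    exact RingQuot.mkAlgHom_rel k (.pMap h x)

variable {L} {A : Type (max u v)} [Ring A] [Algebra k A]

/-- A homomorphism to the Lie algebra of an associative algebra, as a homomorphism of Lie
algebras. -/
def Hom.lieHom (α : Hom L (ofAlgebra R k p A)) : L.carrier →ₗ⁅k⁆ A := α.hom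

/-- The universal property of the enveloping algebra. -/
noncomputable def envelopingLift (α : Hom L (ofAlgebra R k p A)) : Enveloping L →ₐ[k] A :=
  RingQuot.liftAlgHom k ⟨UniversalEnvelopingAlgebra.lift k α.lieHom, by
    rintro _ _ ⟨h, x⟩
    rw [map_pow, UniversalEnvelopingAlgebra.lift_ι_apply, UniversalEnvelopingAlgebra.lift_ι_apply]
    exact α.map_pMap h x⟩

theorem envelopingLift_val (α : Hom L (ofAlgebra R k p A)) (l : L.carrier) :
    envelopingLift α ((envelopingHom L).val l) = α.val l := by
  refine (RingQuot.liftAlgHom_mkAlgHom_apply _ _ _ _).trans ?_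
  exact UniversalEnvelopingAlgebra.lift_ι_apply k α.lieHom l

theorem enveloping_ext {f g : Enveloping L →ₐ[k] A}
    (h : ∀ l, f ((envelopingHom L).val l) = g ((envelopingHom L).val l)) : f = g := by
  refine RingQuot.ringQuot_ext' k f g ?_
  refine UniversalEnvelopingAlgebra.hom_ext k ?_
  ext l
  exact h l

/-- The canonical map factors through the subalgebra it generates; by the universal property, the
lift followed by the inclusion is the identity. -/
theorem adjoin_range_envelopingHom :
    Algebra.adjoin k (Set.range (envelopingHom L).val) = ⊤ := by
  set S := Algebra.adjoin k (Set.range (envelopingHom L).val)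
  let α : Hom L (ofAlgebra R k p S) :=
    { hom :=
        { toFun := fun l => (⟨(envelopingHom L).val l, Algebra.subset_adjoin ⟨l, rfl⟩⟩ : S)
          map_add' := fun x y => Subtype.ext (map_add (envelopingHom L).hom x y)
          map_smul' := fun c x => Subtype.ext (map_smul (envelopingHom L).hom c x)
          map_lie' := fun {x y} => Subtype.ext (LieHom.map_lie (envelopingHom L).hom x y) }
      map_pMap := fun h x => Subtype.ext ((envelopingHom L).map_pMap h x) }
  have h : S.val.comp (envelopingLift α) = AlgHom.id k (Enveloping L) :=
    enveloping_ext fun l => by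
      rw [AlgHom.comp_apply, envelopingLift_val]; rfl
  rw [eq_top_iff]
  intro x _
  have := DFunLike.congr_fun h x
  rw [← show _ = x from this]
  exact (envelopingLift α x).2

variable (L) in
/-- The sum of two commuting homomorphisms. -/
noncomputable def addHom {L N : OptRestrictedLie.{u, w} R k p} (f g : Hom L N)
    (h : ∀ x y, ⁅f.hom x, g.hom y⁆ = 0) : Hom L N :=
  (coprod f g h).comp (pair (Hom.id L) (Hom.id L))

/-- The homomorphism induced by a homomorphism of algebras. -/
def ofAlgHom {A B : Type w} [Ring A] [Algebra k A] [Ring B] [Algebra k B] (f : A →ₐ[k] B) :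
    Hom (ofAlgebra R k p A) (ofAlgebra R k p B) :=
  ofMul f.toLinearMap (map_mul f)

variable (L) in
/-- The homomorphism `l ↦ l ⊗ 1`. -/
noncomputable def leftHom : Hom L (ofAlgebra R k p (Enveloping L ⊗[k] Enveloping L)) :=
  (ofAlgHom Algebra.TensorProduct.includeLeft).comp (envelopingHom L)

variable (L) in
/-- The homomorphism `l ↦ 1 ⊗ l`. -/
noncomputable def rightHom : Hom L (ofAlgebra R k p (Enveloping L ⊗[k] Enveloping L)) :=
  (ofAlgHom Algebra.TensorProduct.includeRight).comp (envelopingHom L)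

theorem leftHom_val (l : L.carrier) : (leftHom L).val l = (envelopingHom L).val l ⊗ₜ 1 := rfl

theorem rightHom_val (l : L.carrier) : (rightHom L).val l = 1 ⊗ₜ (envelopingHom L).val l := rfl

variable (L) in
/-- The homomorphism `l ↦ l ⊗ 1 + 1 ⊗ l`. -/
noncomputable def diagonalHom : Hom L (ofAlgebra R k p (Enveloping L ⊗[k] Enveloping L)) :=
  addHom (leftHom L) (rightHom L) fun x y => by
    change (leftHom L).val x * (rightHom L).val y - (rightHom L).val y * (leftHom L).val x = 0
    rw [leftHom_val, rightHom_val]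
    simp

theorem diagonalHom_val (l : L.carrier) : (diagonalHom L).val l =
    (envelopingHom L).val l ⊗ₜ 1 + 1 ⊗ₜ (envelopingHom L).val l := rfl

variable (L) in
/-- The comultiplication of the enveloping algebra. -/
noncomputable def envelopingComul : Enveloping L →ₐ[k] Enveloping L ⊗[k] Enveloping L :=
  envelopingLift (diagonalHom L)

variable (L) in
/-- The counit of the enveloping algebra. -/
noncomputable def envelopingCounit : Enveloping L →ₐ[k] ULift.{v} k :=
  envelopingLift (zeroHom L (ofAlgebra R k p (ULift.{v} k)))

variable (L) in
/-- The first step of the filtration of the enveloping algebra by degree. -/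
noncomputable def envelopingGen : Submodule k (Enveloping L) :=
  1 ⊔ LinearMap.range (envelopingHom L).hom.toLinearMap

theorem one_le_envelopingGen : 1 ≤ envelopingGen L := le_sup_left

theorem envelopingGen_pow_mono {m n : ℕ} (h : m ≤ n) : envelopingGen L ^ m ≤ envelopingGen L ^ n :=
  pow_le_pow_right₀ one_le_envelopingGen h

theorem val_mem_envelopingGen (l : L.carrier) : (envelopingHom L).val l ∈ envelopingGen L :=
  Submodule.mem_sup_right ⟨l, rfl⟩

theorem exists_mem_envelopingGen_pow (x : Enveloping L) : ∃ n, x ∈ envelopingGen L ^ n := by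
  have hx : x ∈ Algebra.adjoin k (Set.range (envelopingHom L).val) := by
    rw [adjoin_range_envelopingHom]; trivial
  induction hx using Algebra.adjoin_induction with
  | mem x hx =>
    obtain ⟨l, rfl⟩ := hx
    exact ⟨1, by rw [pow_one]; exact val_mem_envelopingGen l⟩
  | algebraMap c => exact ⟨0, by rw [pow_zero]; exact Submodule.algebraMap_mem c⟩
  | add x y _ _ hx hy =>
    obtain ⟨m, hm⟩ := hx
    obtain ⟨n, hn⟩ := hy
    exact ⟨max m n, add_mem (envelopingGen_pow_mono (le_max_left m n) hm)
      (envelopingGen_pow_mono (le_max_right m n) hn)⟩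
  | mul x y _ _ hx hy =>
    obtain ⟨m, hm⟩ := hx
    obtain ⟨n, hn⟩ := hy
    exact ⟨m + n, by rw [pow_add]; exact Submodule.mul_mem_mul hm hn⟩

/-- The generators are primitive, and multiplication by l ⊗ 1 + 1 ⊗ l gives two terms, each raising
one of the two degrees by one. -/
theorem envelopingComul_mem {n : ℕ} {x : Enveloping L} (hx : x ∈ envelopingGen L ^ n) :
    envelopingComul L x ∈ Submodule.span k {z : Enveloping L ⊗[k] Enveloping L |
      ∃ i j, i + j = n ∧ ∃ a ∈ envelopingGen L ^ i, ∃ b ∈ envelopingGen L ^ j, z = a ⊗ₜ b} := by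
  induction n generalizing x with
  | zero =>
    rw [pow_zero] at hx
    obtain ⟨c, rfl⟩ := Submodule.mem_one.1 hx
    rw [AlgHom.commutes, Algebra.algebraMap_eq_smul_one]
    exact Submodule.smul_mem _ _ (Submodule.subset_span
      ⟨0, 0, rfl, 1, by rw [pow_zero]; exact Submodule.one_le.1 le_rfl, 1,
        by rw [pow_zero]; exact Submodule.one_le.1 le_rfl, rfl⟩)
  | succ n ih =>
    rw [pow_succ] at hx
    induction hx using Submodule.mul_induction_on' with
    | add x _ y _ hx hy => rw [map_add]; exact add_mem hx hy
    | mem_mul_mem x hx y hy =>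
      rw [map_mul]
      have hx' := ih hx
      generalize envelopingComul L x = z at hx'
      obtain ⟨c, hc, _, ⟨l, rfl⟩, rfl⟩ := Submodule.mem_sup.1 hy
      obtain ⟨c, rfl⟩ := Submodule.mem_one.1 hc
      change z * envelopingComul L (_ + (envelopingHom L).val l) ∈ _
      rw [map_add, AlgHom.commutes, envelopingComul, envelopingLift_val, diagonalHom_val]
      induction hx' using Submodule.span_induction with
      | zero => rw [zero_mul]; exact zero_mem _
      | add a b _ _ ha hb => rw [add_mul]; exact add_mem ha hb
      | smul c a _ ha => rw [smul_mul_assoc]; exact Submodule.smul_mem _ c ha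
      | mem a ha =>
        obtain ⟨i, j, hij, a, ha, b, hb, rfl⟩ := ha
        rw [mul_add, mul_add, Algebra.algebraMap_eq_smul_one, mul_smul_comm, mul_one,
          Algebra.TensorProduct.tmul_mul_tmul, Algebra.TensorProduct.tmul_mul_tmul, mul_one,
          mul_one]
        have ha' : a ∈ envelopingGen L ^ (i + 1) := envelopingGen_pow_mono (Nat.le_succ i) ha
        refine add_mem (Submodule.smul_mem _ _ (Submodule.subset_span ?_))
          (add_mem (Submodule.subset_span ?_) (Submodule.subset_span ?_))
        · exact ⟨i + 1, j, by omega, a, ha', b, hb, rfl⟩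
        · refine ⟨i + 1, j, by omega, _, ?_, b, hb, rfl⟩
          rw [pow_succ]; exact Submodule.mul_mem_mul ha (val_mem_envelopingGen l)
        · refine ⟨i, j + 1, by omega, a, ha, _, ?_, rfl⟩
          rw [pow_succ]; exact Submodule.mul_mem_mul hb (val_mem_envelopingGen l)

/-- The only group-like element of the enveloping algebra is `1`. -/
theorem eq_one_of_envelopingComul_eq {x : Enveloping L} (hx : envelopingComul L x = x ⊗ₜ x)
    (h1 : envelopingCounit L x = 1) : x = 1 := by
  classical
  rw [← sub_eq_zero]
  set y := x - 1 with hy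
  have hcomul : envelopingComul L y = y ⊗ₜ y + y ⊗ₜ 1 + 1 ⊗ₜ y := by
    rw [hy, map_sub, hx, map_one, Algebra.TensorProduct.one_def]
    simp only [TensorProduct.sub_tmul, TensorProduct.tmul_sub]
    abel
  -- Take the least filtration degree of y. In degree 0, y is a scalar killed by the counit. In
  -- degree m + 1, choose φ vanishing in degree m but not at y: φ ⊗ φ kills the coproduct of y, yet
  -- takes the value φ(y)² there.
  have hex := exists_mem_envelopingGen_pow y
  have hmin := Nat.find_spec hex
  rcases hn : Nat.find hex with _ | m
  · rw [hn, pow_zero] at hmin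
    obtain ⟨c, hc⟩ := Submodule.mem_one.1 hmin
    have h0 : envelopingCounit L y = 0 := by rw [hy, map_sub, h1, map_one, sub_self]
    rw [← hc, AlgHom.commutes] at h0
    have hc0 : c = 0 := congrArg ULift.down h0
    rw [← hc, hc0, map_zero]
  · rw [hn] at hmin
    exfalso
    have hm : y ∉ envelopingGen L ^ m := Nat.find_min hex (by omega)
    obtain ⟨φ, hφy, hφ⟩ := Submodule.exists_dual_map_eq_bot_of_notMem hm inferInstance
    have hφ0 : ∀ a ∈ envelopingGen L ^ m, φ a = 0 := fun a ha => by
      have : φ a ∈ (envelopingGen L ^ m).map φ := Submodule.mem_map_of_mem ha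
      rwa [hφ] at this
    let Φ : Enveloping L ⊗[k] Enveloping L →ₗ[k] k := LinearMap.mul' k k ∘ₗ TensorProduct.map φ φ
    have hΦ : ∀ a b, Φ (a ⊗ₜ b) = φ a * φ b := fun a b => rfl
    have hker : Φ (envelopingComul L y) = 0 := by
      have h := envelopingComul_mem hmin
      generalize envelopingComul L y = z at h
      induction h using Submodule.span_induction with
      | zero => exact map_zero Φ
      | add a b _ _ ha hb => rw [map_add, ha, hb, add_zero]
      | smul c a _ ha => rw [map_smul, ha, smul_zero]
      | mem a ha =>
        obtain ⟨i, j, hij, a, ha, b, hb, rfl⟩ := ha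
        rw [hΦ]
        rcases le_or_gt i m with hi | hi
        · rw [hφ0 a (envelopingGen_pow_mono hi ha), zero_mul]
        -- Here i = m + 1, so j = 0 and b has degree at most m.
        · rw [hφ0 b (envelopingGen_pow_mono (by omega) hb), mul_zero]
    have h1' : φ 1 = 0 := hφ0 1 (envelopingGen_pow_mono (Nat.zero_le m)
      (by rw [pow_zero]; exact Submodule.one_le.1 le_rfl))
    rw [hcomul, map_add, map_add, hΦ, hΦ, hΦ, h1', mul_zero, zero_mul, add_zero, add_zero] at hker
    exact hφy (mul_self_eq_zero.1 hker)

end Enveloping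

end OptRestrictedLie

/-! ### Matrix algebras over the enveloping algebra -/

section Corner

variable {k : Type*} [Field k] {A : Type*} [Ring A] [Algebra k A] {m n : Type*} [Fintype m]
  [DecidableEq m] [Fintype n] [DecidableEq n]

/-- The block embedding of matrix algebras given by an embedding of index types. -/
def Matrix.corner (k : Type*) [Field k] {A : Type*} [Ring A] [Algebra k A] (e : m ↪ n) :
    Matrix m m A →ₗ[k] Matrix n n A where
  toFun X := (1 : Matrix n n A).submatrix id e * X * (1 : Matrix n n A).submatrix e id
  map_add' X Y := by rw [Matrix.mul_add, Matrix.add_mul]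
  map_smul' c X := by rw [Matrix.mul_smul, Matrix.smul_mul]; rfl

/-- The two rectangular 0-1 matrices multiply to the identity of the smaller size, so the embedding
is multiplicative, though in general not unital. -/
theorem Matrix.corner_mul (e : m ↪ n) (X Y : Matrix m m A) :
    Matrix.corner k e (X * Y) = Matrix.corner k e X * Matrix.corner k e Y := by
  have h : (1 : Matrix n n A).submatrix e id * (1 : Matrix n n A).submatrix id e = 1 := by
    rw [← Matrix.submatrix_mul _ _ e id e Function.bijective_id, Matrix.mul_one,
      Matrix.submatrix_one_embedding]
  simp only [Matrix.corner, LinearMap.coe_mk, AddHom.coe_mk]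
  rw [Matrix.mul_assoc _ _ ((1 : Matrix n n A).submatrix id e * Y * _),
    ← Matrix.mul_assoc ((1 : Matrix n n A).submatrix e id),
    ← Matrix.mul_assoc ((1 : Matrix n n A).submatrix e id), h, Matrix.one_mul]
  simp only [Matrix.mul_assoc]

omit [Fintype n] in
theorem Matrix.corner_single (e : m ↪ n) (i j : m) (a : A) :
    Matrix.corner k e (Matrix.single i j a) = Matrix.single (e i) (e j) a := by
  ext r s
  simp [Matrix.corner, Matrix.mul_apply, Matrix.single_apply, Matrix.one_apply, ite_and,
    eq_comm]
  rw [Finset.sum_eq_single j (fun b _ hb => by simp [hb.symm]) (by simp)]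
  by_cases h1 : r = e i <;> by_cases h2 : s = e j <;> simp [h1, h2]

omit [Fintype n] in
theorem Matrix.corner_apply_apply (e : m ↪ n) (X : Matrix m m A) (i j : m) :
    Matrix.corner k e X (e i) (e j) = X i j := by
  simp [Matrix.corner, Matrix.mul_apply, Matrix.one_apply]

theorem Matrix.commute_corner (e : m ↪ n) (X : Matrix m m A) (Y : Matrix n n A)
    (h : ∀ i j, Commute (Matrix.single (e i) (e j) (X i j)) Y) :
    Commute (Matrix.corner k e X) Y := by
  rw [Matrix.matrix_eq_sum_single X, map_sum]
  refine Commute.sum_left _ _ _ fun i _ => ?_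
  rw [map_sum]
  refine Commute.sum_left _ _ _ fun j _ => ?_
  rw [Matrix.corner_single]
  exact h i j

theorem Matrix.commute_single_single {i j l : n} (hi : i ≠ l) (hj : j ≠ l) (a b : A) :
    Commute (Matrix.single i j a) (Matrix.single l l b) := by
  rw [Commute, SemiconjBy, Matrix.single_mul_single_of_ne _ _ _ _ hj,
    Matrix.single_mul_single_of_ne _ _ _ _ hi.symm]

/-- The embedding of scalars as matrices with a single diagonal entry. -/
def Matrix.singleDiag (k : Type*) [Field k] {A : Type*} [Ring A] [Algebra k A] (i : n) :
    A →ₗ[k] Matrix n n A where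
  toFun a := Matrix.single i i a
  map_add' a b := Matrix.single_add i i a b
  map_smul' c a := (Matrix.smul_single c i i a).symm

end Corner

namespace OptRestrictedLie

variable {R : Prop} {k : Type u} [Field k] {p : ℕ} [hR : RestrictedParam R k p]
  {L : OptRestrictedLie.{u, max u v} R k p} {A B : Type (max u v)} [Ring A] [Algebra k A]
  [Ring B] [Algebra k B] {n : Type} [Fintype n] [DecidableEq n]

/-- A homomorphism to an associative algebra, placed at a diagonal entry of a matrix algebra. -/
def singleHom (i : n) (α : Hom L (ofAlgebra R k p A)) :
    Hom L (ofAlgebra R k p (Matrix n n A)) :=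
  (ofMul (Matrix.singleDiag k i) fun a b =>
    (Matrix.single_mul_single_same a i i i b).symm).comp α

theorem singleHom_val (i : n) (α : Hom L (ofAlgebra R k p A)) (l : L.carrier) :
    (singleHom i α).val l = Matrix.single i i (α.val l) := rfl

/-- The block embedding of matrix algebras, combined with a homomorphism of coefficients. -/
def cornerHom {m : Type} [Fintype m] [DecidableEq m] (e : m ↪ n) (F : A →ₐ[k] B) :
    Hom (ofAlgebra R k p (Matrix m m A)) (ofAlgebra R k p (Matrix n n B)) :=
  (ofMul (Matrix.corner k e) (Matrix.corner_mul e)).comp (ofAlgHom F.mapMatrix)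

/-! ### Action of a natural endomorphism on matrix units -/

namespace NatEndo

variable (η : NatEndo L)

/-- Two homomorphisms to associative algebras related by a third one. -/
theorem endo_naturality (f : Hom L (ofAlgebra R k p A)) (g : Hom (ofAlgebra R k p A)
    (ofAlgebra R k p B)) (h : Hom L (ofAlgebra R k p B)) (G : A → B) (hG : ∀ x : A, g.hom x = G x)
    (hh : ∀ l, h.val l = G (f.val l)) (x : A) : η.endo h (G x) = G (η.endo f x) := by
  have := η.naturality' f g h (fun l => (hh l).trans (hG _).symm) x
  exact ((congrArg (η.app h).hom (hG x)).symm.trans this).trans (hG _)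

variable (hn : η.nilScalar = 1) (ht : η.torScalar = 1)

section

variable (α : Hom L (ofAlgebra R k p A))

open Matrix

-- L occupies only the entry (0,0), so a matrix supported away from row and column 0 commutes with
-- it; an off-diagonal one squares to zero.
include hn in
theorem endo_single_of_ne {i j : Fin 3} (hij : i ≠ j) (hi : i ≠ 0) (hj : j ≠ 0) (a : A) :
    η.endo (singleHom (0 : Fin 3) α) (single i j a) = single i j a := by
  rw [η.endo_of_mul_self_eq_zero, hn, one_smul]
  · exact single_mul_single_of_ne _ _ _ _ hij.symm _
  · intro l
    rw [singleHom_val, Commute, SemiconjBy, single_mul_single_of_ne _ _ _ _ hj,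
      single_mul_single_of_ne _ _ _ _ hi.symm]

include ht in
theorem endo_single_one (i : Fin 3) :
    η.endo (singleHom (0 : Fin 3) α) (single i i 1) = single i i 1 := by
  rw [η.endo_of_mul_self_eq_self, ht, one_smul]
  · rw [single_mul_single_same, mul_one]
  · intro l
    rw [singleHom_val, Commute, SemiconjBy]
    rcases eq_or_ne i 0 with rfl | hi
    · rw [single_mul_single_same, single_mul_single_same, mul_one, one_mul]
    · rw [single_mul_single_of_ne _ _ _ _ hi, single_mul_single_of_ne _ _ _ _ hi.symm]

-- The image X satisfies [E00, X] = X and [E22, X] = [E21, X] = 0. The first relation kills the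
-- entries with both or neither index 0, but leaves column 0 undecided in characteristic 2; the
-- other two kill that column and the entry (0,2).
include hn ht in
theorem exists_endo_single_zero_one (a : A) :
    ∃ b, η.endo (singleHom (0 : Fin 3) α) (single 0 1 a) = single 0 1 b := by
  set X := η.endo (singleHom (0 : Fin 3) α) (single 0 1 a) with hX
  have h1 := η.endo_commutator (singleHom (0 : Fin 3) α) (single 0 0 1) (single 0 1 a)
  have h2 := η.endo_commutator (singleHom (0 : Fin 3) α) (single 2 2 1) (single 0 1 a)
  have h3 := η.endo_commutator (singleHom (0 : Fin 3) α) (single 2 1 1) (single 0 1 a)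
  have e1 : (single 0 0 1 * single 0 1 a - single 0 1 a * single 0 0 1 :
      Matrix (Fin 3) (Fin 3) A) = single 0 1 a := by simp
  have e2 : (single 2 2 1 * single 0 1 a - single 0 1 a * single 2 2 1 :
      Matrix (Fin 3) (Fin 3) A) = 0 := by simp
  have e3 : (single 2 1 1 * single 0 1 a - single 0 1 a * single 2 1 1 :
      Matrix (Fin 3) (Fin 3) A) = 0 := by simp
  rw [e1, ← hX, η.endo_single_one ht] at h1
  rw [e2, ← hX, η.endo_single_one ht, map_zero] at h2
  rw [e3, ← hX, η.endo_single_of_ne hn α (by decide) (by decide) (by decide), map_zero] at h3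
  refine ⟨X 0 1, ?_⟩
  have h1' := fun i j => congrArg (fun Y : Matrix (Fin 3) (Fin 3) A => Y i j) h1
  have h02 := congrArg (fun Y : Matrix (Fin 3) (Fin 3) A => Y 0 2) h2
  have h20 := congrArg (fun Y : Matrix (Fin 3) (Fin 3) A => Y 2 0) h2
  have h10 := congrArg (fun Y : Matrix (Fin 3) (Fin 3) A => Y 2 0) h3
  simp only [Matrix.sub_apply, mul_apply, Fin.sum_univ_three] at h1' h02 h20 h10
  have a00 := h1' 0 0
  have a11 := h1' 1 1
  have a12 := h1' 1 2
  have a21 := h1' 2 1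
  have a22 := h1' 2 2
  clear h1' h1 h2 h3 hX
  simp at a00 a11 a12 a21 a22 h02 h20 h10
  ext i j
  fin_cases i <;> fin_cases j <;> simp [a00, a11, a12, a21, a22, h02, ← h20, ← h10]

/-- The element describing the action of `η` on the first row of matrices. -/
noncomputable def unit : A := η.endo (singleHom (0 : Fin 3) α) (single 0 1 1) 0 1

-- [E01(a), E12] = [E01, E12(a)], and η fixes E12 and E12(a); compare the entries (0,2) of the
-- images.
include hn ht in
theorem endo_single_zero_one (a : A) :
    η.endo (singleHom (0 : Fin 3) α) (single 0 1 a) = single 0 1 (η.unit α * a) := by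
  obtain ⟨b, hb⟩ := η.exists_endo_single_zero_one hn ht α a
  obtain ⟨c, hc⟩ := η.exists_endo_single_zero_one hn ht α 1
  have hu : η.unit α = c := by rw [unit, hc]; simp
  have h1 := η.endo_commutator (singleHom (0 : Fin 3) α) (single 0 1 a) (single 1 2 1)
  have h2 := η.endo_commutator (singleHom (0 : Fin 3) α) (single 0 1 1) (single 1 2 a)
  rw [η.endo_single_of_ne hn α (i := 1) (by decide) (by decide) (by decide), hb] at h1
  rw [η.endo_single_of_ne hn α (i := 1) (by decide) (by decide) (by decide), hc] at h2
  have e : (single 0 1 a * single 1 2 1 - single 1 2 1 * single 0 1 a :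
      Matrix (Fin 3) (Fin 3) A) = single 0 1 1 * single 1 2 a - single 1 2 a * single 0 1 1 := by
    simp
  rw [e, h2] at h1
  have := congrArg (fun Y : Matrix (Fin 3) (Fin 3) A => Y 0 2) h1
  simp at this
  rw [hb, hu, this]

/-- This naturality makes the unit of any α the image of a single element of the enveloping algebra.
-/
theorem unit_comp (F : A →ₐ[k] B) (β : Hom L (ofAlgebra R k p B))
    (hβ : ∀ l, β.val l = F (α.val l)) : η.unit β = F (η.unit α) := by
  have := η.endo_naturality (singleHom (0 : Fin 3) α) (ofAlgHom F.mapMatrix)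
    (singleHom (0 : Fin 3) β) F.mapMatrix (fun _ => rfl)
    (fun l => by
      rw [singleHom_val, singleHom_val, hβ, AlgHom.mapMatrix_apply, map_single]) (single 0 1 1)
  rw [AlgHom.mapMatrix_apply, map_single, map_one] at this
  rw [unit, this]; rfl

-- The result is transferred through the corner embedding of 2×2 into 3×3 matrices. In the smaller
-- size it can be combined with an action of L on the remaining diagonal entry.
include hn ht in
theorem endo_single_zero_one_two :
    η.endo (singleHom (0 : Fin 2) α) (single 0 1 1) = single 0 1 (η.unit α) := by
  have h := η.endo_naturality (singleHom (0 : Fin 2) α)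
    (ofMul (corner k (Fin.castSuccEmb (n := 2))) (corner_mul _)) (singleHom (0 : Fin 3) α)
    (corner k Fin.castSuccEmb) (fun _ => rfl)
    (fun l => by rw [singleHom_val, singleHom_val, corner_single]; rfl) (single 0 1 1)
  rw [corner_single] at h
  have h' := (η.endo_single_zero_one hn ht α 1).symm.trans h
  ext i j
  refine (corner_apply_apply (k := k) (Fin.castSuccEmb (n := 2)) _ i j).symm.trans ?_
  rw [← h', mul_one]
  simp [single_apply, Fin.ext_iff]

end

/-- The action of `η` on a matrix unit depends only on the corresponding two diagonal entries. -/
theorem endo_single_corner (hn : η.nilScalar = 1) (ht : η.torScalar = 1)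
    (α : Hom L (ofAlgebra R k p A)) (F : A →ₐ[k] B) (e : Fin 2 ↪ Fin 3)
    (g h : Hom L (ofAlgebra R k p (Matrix (Fin 3) (Fin 3) B)))
    (hg : ∀ (X : Matrix (Fin 2) (Fin 2) A) l,
      Commute (Matrix.corner k e (F.mapMatrix X)) (g.val l))
    (hh : ∀ l, h.val l = Matrix.single (e 0) (e 0) (F (α.val l)) + g.val l) :
    η.endo h (Matrix.single (e 0) (e 1) 1) = Matrix.single (e 0) (e 1) (F (η.unit α)) := by
  have h1 := η.app_of_commute (singleHom (0 : Fin 2) α) (cornerHom e F) g h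
    (fun X l => sub_eq_zero.2 (hg X l))
    (fun l => by
      refine (hh l).trans (congrArg (· + g.val l) ?_)
      change _ = Matrix.corner k e (F.mapMatrix ((singleHom (0 : Fin 2) α).val l))
      rw [singleHom_val, AlgHom.mapMatrix_apply, Matrix.map_single, Matrix.corner_single])
    (Matrix.single 0 1 1 : Matrix (Fin 2) (Fin 2) A)
  change η.endo h (Matrix.corner k e (F.mapMatrix (Matrix.single 0 1 1))) =
    Matrix.corner k e (F.mapMatrix (η.endo (singleHom (0 : Fin 2) α) (Matrix.single 0 1 1))) at h1
  rwa [η.endo_single_zero_one_two hn ht, AlgHom.mapMatrix_apply, AlgHom.mapMatrix_apply,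
    Matrix.map_single, Matrix.map_single, Matrix.corner_single, Matrix.corner_single,
    map_one F] at h1

end NatEndo

end OptRestrictedLie

/-! ### Triviality of natural endomorphisms -/

namespace OptRestrictedLie

variable {R : Prop} {k : Type u} [Field k] {p : ℕ} [hR : RestrictedParam R k p]
  {L : OptRestrictedLie.{u, max u v} R k p}

namespace NatEndo

variable (η : NatEndo L) (hn : η.nilScalar = 1) (ht : η.torScalar = 1)

include hn ht

open Matrix

/-- Let L act by the diagonal matrices with entries Δ(l), 1 ⊗ l, 0. Only the entries i and j matter
for E_ij, and a common commuting summand may be dropped. So E01, E12 and E02 are multiplied by u ⊗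
1, 1 ⊗ u and Δ(u), and [E01, E12] = E02 concludes. -/
theorem envelopingComul_unit :
    envelopingComul L (η.unit (envelopingHom L)) =
      η.unit (envelopingHom L) ⊗ₜ η.unit (envelopingHom L) := by
  have hcomm : ∀ (i j : Fin 3), i ≠ j → ∀ (a b : Enveloping L ⊗[k] Enveloping L),
      (single i i a * single j j b - single j j b * single i i a :
        Matrix (Fin 3) (Fin 3) (Enveloping L ⊗[k] Enveloping L)) = 0 := fun i j hij a b => by
    rw [single_mul_single_of_ne _ _ _ _ hij, single_mul_single_of_ne _ _ _ _ hij.symm, sub_zero]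
  let h := addHom (singleHom (0 : Fin 3) (diagonalHom L)) (singleHom (1 : Fin 3) (rightHom L))
    fun x y => hcomm 0 1 (by decide) ((diagonalHom L).val x) ((rightHom L).val y)
  have hh : ∀ l, h.val l = single 0 0 ((diagonalHom L).val l) + single 1 1 ((rightHom L).val l) :=
    fun l => rfl
  let g := addHom (singleHom (0 : Fin 3) (rightHom L)) (singleHom (1 : Fin 3) (rightHom L))
    fun x y => hcomm 0 1 (by decide) ((rightHom L).val x) ((rightHom L).val y)
  have hg : ∀ l, g.val l = single 0 0 ((rightHom L).val l) + single 1 1 ((rightHom L).val l) :=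
    fun l => rfl
  let e01 : Fin 2 ↪ Fin 3 := ⟨![0, 1], by decide⟩
  let e02 : Fin 2 ↪ Fin 3 := ⟨![0, 2], by decide⟩
  let e12 : Fin 2 ↪ Fin 3 := ⟨![1, 2], by decide⟩
  -- Removing 1 ⊗ l from both of the first two diagonal entries leaves l ⊗ 1 and 0; what is removed
  -- commutes with all 2×2 blocks over the left tensor factor.
  have h01 : η.endo h (single 0 1 1) = single 0 1 (η.unit (envelopingHom L) ⊗ₜ 1) := by
    refine η.endo_single_corner hn ht (envelopingHom L) Algebra.TensorProduct.includeLeft e01 g h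
      ?_ ?_
    · intro X l
      have hc (a : Enveloping L) : Commute (a ⊗ₜ[k] (1 : Enveloping L)) ((rightHom L).val l) := by
        rw [rightHom_val, Commute, SemiconjBy]; simp
      refine commute_corner (k := k) e01 _ _ fun i j => ?_
      have hX : (Algebra.TensorProduct.includeLeft :
          Enveloping L →ₐ[k] Enveloping L ⊗[k] Enveloping L).mapMatrix X i j =
        X i j ⊗ₜ[k] (1 : Enveloping L) := rfl
      rw [hX, hg, Commute, SemiconjBy, mul_add, add_mul]
      fin_cases i <;> fin_cases j <;> simp [e01, (hc _).eq]
    · intro l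
      rw [hh, hg, diagonalHom_val, single_add, add_assoc]; rfl
  have h12 : η.endo h (single 1 2 1) = single 1 2 (1 ⊗ₜ η.unit (envelopingHom L)) := by
    refine η.endo_single_corner hn ht (envelopingHom L) Algebra.TensorProduct.includeRight e12
      (singleHom (0 : Fin 3) (diagonalHom L)) h ?_ ?_
    · exact fun X l => commute_corner (k := k) e12 _ _ fun i j =>
        commute_single_single (by revert i; decide) (by revert j; decide) _ _
    · intro l
      rw [hh, add_comm]; rfl
  have h02 : η.endo h (single 0 2 1) = single 0 2 (envelopingComul L (η.unit (envelopingHom L))) := by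
    refine η.endo_single_corner hn ht (envelopingHom L) (envelopingComul L) e02
      (singleHom (1 : Fin 3) (rightHom L)) h ?_ ?_
    · exact fun X l => commute_corner (k := k) e02 _ _ fun i j =>
        commute_single_single (by revert i; decide) (by revert j; decide) _ _
    · intro l
      rw [hh, envelopingComul, envelopingLift_val]; rfl
  have hc := η.endo_commutator h (single 0 1 1) (single 1 2 1)
  have e : (single 0 1 1 * single 1 2 1 - single 1 2 1 * single 0 1 1 :
      Matrix (Fin 3) (Fin 3) (Enveloping L ⊗[k] Enveloping L)) = single 0 2 1 := by simp
  rw [e, h01, h12, h02] at hc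
  have := congrArg (fun Y : Matrix (Fin 3) (Fin 3) (Enveloping L ⊗[k] Enveloping L) => Y 0 2) hc
  simpa using this

-- By naturality the counit sends u to the unit of the zero homomorphism, for which E01 commutes
-- with L and is therefore fixed.
omit ht in
theorem envelopingCounit_unit : envelopingCounit L (η.unit (envelopingHom L)) = 1 := by
  rw [← η.unit_comp (envelopingHom L) (envelopingCounit L) (zeroHom L _)
    (fun l => (envelopingLift_val _ l).symm), unit, η.endo_of_mul_self_eq_zero, hn, one_smul,
    single_apply_same]
  · exact single_mul_single_of_ne _ _ _ _ (by decide) _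
  · intro l
    have : (singleHom (0 : Fin 3) (zeroHom L (ofAlgebra R k p (ULift.{v} k)))).val l = 0 :=
      single_zero 0 0
    rw [this]
    exact Commute.zero_right _

variable {A : Type (max u v)} [Ring A] [Algebra k A] (α : Hom L (ofAlgebra R k p A))

theorem unit_eq_one : η.unit α = 1 := by
  rw [η.unit_comp (envelopingHom L) (envelopingLift α) α fun l => (envelopingLift_val α l).symm,
    eq_one_of_envelopingComul_eq (η.envelopingComul_unit hn ht) (η.envelopingCounit_unit hn),
    map_one]

/-- Since u = 1, both E01 and E01(a) = [E00(a), E01] are fixed. By naturality E00(a) goes to E00(η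
a), so E01(a) = E01(η a). -/
theorem endo_eq_self (a : A) : η.endo α a = a := by
  have h := η.endo_naturality α (ofMul (singleDiag k (0 : Fin 3)) fun a b =>
    (single_mul_single_same a 0 0 0 b).symm) (singleHom (0 : Fin 3) α) (single 0 0)
    (fun _ => rfl) (fun _ => rfl) a
  have hc := η.endo_commutator (singleHom (0 : Fin 3) α) (single 0 0 a) (single 0 1 1)
  have e : (single 0 0 a * single 0 1 1 - single 0 1 1 * single 0 0 a :
      Matrix (Fin 3) (Fin 3) A) = single 0 1 a := by simp
  rw [e, h, η.endo_single_zero_one hn ht, η.endo_single_zero_one hn ht, η.unit_eq_one hn ht] at hc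
  have := congrArg (fun Y : Matrix (Fin 3) (Fin 3) A => Y 0 1) hc
  simpa using this.symm

/-- Naturality along the adjoint representation gives ad(η x) = η(ad x), which is ad x because η is
the identity on End M. -/
theorem lie_app {M : OptRestrictedLie.{u, max u v} R k p} (f : Hom L M) (x y : M.carrier) :
    ⁅y, (η.app f).hom x⁆ = ⁅y, x⁆ := by
  have h : η.endo ((adHom M).comp f) (LieAlgebra.ad k M.carrier x) =
      LieAlgebra.ad k M.carrier ((η.app f).hom x) := η.naturality f (adHom M) x
  rw [η.endo_eq_self hn ht] at h
  have h' := LinearMap.congr_fun h y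
  rw [LieAlgebra.ad_apply, LieAlgebra.ad_apply] at h'
  rw [← lie_skew, ← h', lie_skew]

omit hn ht in
/-- The only natural endomorphisms are `0` and the identity. -/
theorem eq_zero_or_eq_self :
    (∀ {M : OptRestrictedLie.{u, max u v} R k p} (f : Hom L M) (x : M.carrier),
      (η.app f).hom x = 0) ∨
    (∀ {M : OptRestrictedLie.{u, max u v} R k p} (f : Hom L M) (x : M.carrier),
      (η.app f).hom x = x) := by
  obtain ⟨h1, h2⟩ := η.scalars_eq
  rcases eq_or_ne η.nilScalar 0 with h0 | h0
  · left
    intro M f x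
    exact η.app_eq_zero (h2.trans h0) f x
  · right
    intro M f x
    have hn : η.nilScalar = 1 := mul_left_cancel₀ h0 (h1.trans (mul_one _).symm)
    exact η.app_eq_self (h2.trans hn) (η.lie_app hn (h2.trans hn)) f x

end NatEndo

end OptRestrictedLie

/-! ### The main theorem -/

/-- The exponent 0 is a placeholder: p-maps are present only when `R` holds. -/
instance (k : Type u) [Field k] : RestrictedParam False k 0 := ⟨False.elim, False.elim⟩

instance (k : Type u) [Field k] (p : ℕ) [hp : Fact p.Prime] [hk : CharP k p] :
    RestrictedParam True k p := ⟨fun _ => hp.out, fun _ => hk⟩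

namespace LieAlgCat

variable {k : Type u} [Field k]

/-- A Lie algebra, in the common framework. -/
def toOpt (L : LieAlgCat.{u, w} k) : OptRestrictedLie.{u, w} False k 0 := ⟨L.carrier, False.elim⟩

/-- The natural endomorphism given by a universal endomorphism. -/
def natEndo {L : LieAlgCat.{u, w} k} (η : UniversalEndomorphism L) :
    OptRestrictedLie.NatEndo L.toOpt where
  app {M} f := ⟨(η.app (Under.mk (Y := (⟨M.carrier⟩ : LieAlgCat.{u, w} k)) ⟨f.hom⟩)).hom,
    fun h => h.elim⟩
  naturality {M N} f g x := by
    let X : Under L := Under.mk (Y := (⟨M.carrier⟩ : LieAlgCat.{u, w} k)) ⟨f.hom⟩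
    let Y : Under L := Under.mk (Y := (⟨N.carrier⟩ : LieAlgCat.{u, w} k)) ⟨(g.comp f).hom⟩
    let G : X ⟶ Y := Under.homMk ⟨g.hom⟩ rfl
    exact LieHom.congr_fun (congrArg Hom.hom (η.naturality G)) x

end LieAlgCat

namespace RestrictedLieAlgCat

variable {k : Type u} [Field k] {p : ℕ}

/-- A restricted Lie algebra, in the common framework. -/
def toOpt (L : RestrictedLieAlgCat.{u, w} k p) : OptRestrictedLie.{u, w} True k p :=
  ⟨L.carrier, fun _ => L.restricted⟩

/-- The restricted Lie algebra defined by an object of the common framework. -/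
def ofOpt (L : OptRestrictedLie.{u, w} True k p) : RestrictedLieAlgCat.{u, w} k p :=
  @RestrictedLieAlgCat.mk k p _ L.carrier _ _ (L.str trivial)

/-- The natural endomorphism given by a universal endomorphism. -/
def natEndo {L : RestrictedLieAlgCat.{u, w} k p} (η : UniversalEndomorphism L) :
    OptRestrictedLie.NatEndo L.toOpt where
  app {M} f := ⟨(η.app (Under.mk (Y := ofOpt M) ⟨f.hom, f.map_pMap trivial⟩)).hom,
    fun _ => (η.app (Under.mk (Y := ofOpt M) ⟨f.hom, f.map_pMap trivial⟩)).map_pMap⟩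
  naturality {M N} f g x := by
    let X : Under L := Under.mk (Y := ofOpt M) ⟨f.hom, f.map_pMap trivial⟩
    let Y : Under L := Under.mk (Y := ofOpt N) ⟨(g.comp f).hom, (g.comp f).map_pMap trivial⟩
    let G : X ⟶ Y := Under.homMk ⟨g.hom, g.map_pMap trivial⟩ rfl
    exact LieHom.congr_fun (congrArg Hom.hom (η.naturality G)) x

end RestrictedLieAlgCat

theorem mainTheorem2 (k : Type u) [Field k] :
    (∀ (L : LieAlgCat.{u, max u v} k) (η : UniversalEndomorphism L),
      η = 0 ∨ η = 𝟙 (Under.forget L)) ∧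
    (∀ (p : ℕ) [Fact p.Prime] [CharP k p] (L : RestrictedLieAlgCat.{u, max u v} k p)
      (η : UniversalEndomorphism L), η = 0 ∨ η = 𝟙 (Under.forget L)) := by
  refine ⟨fun L η => ?_, fun p _ _ L η => ?_⟩
  · refine (LieAlgCat.natEndo η).eq_zero_or_eq_self.imp (fun h => ?_) (fun h => ?_) <;>
    · refine NatTrans.ext (funext fun X => LieAlgCat.Hom.ext (LieHom.ext fun x => ?_))
      exact h (M := LieAlgCat.toOpt X.right) ⟨X.hom.hom, fun h => h.elim⟩ x
  · refine (RestrictedLieAlgCat.natEndo η).eq_zero_or_eq_self.imp (fun h => ?_) (fun h => ?_) <;>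
    · refine NatTrans.ext (funext fun X => RestrictedLieAlgCat.Hom.ext (LieHom.ext fun x => ?_))
      exact h (M := RestrictedLieAlgCat.toOpt X.right) ⟨X.hom.hom, fun _ => X.hom.map_pMap⟩ x
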